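/- Let $V(x)=x_1^2x_2-\frac13 x_2^3$ on $\mathbb R^2$; denote also by $V$ the maximal operator of multiplication by $V(x)$ in $L^2(\mathbb R^2)$, with domain $D(V)=\{u\in L^2(\mathbb R^2): Vu\in L^2(\mathbb R^2)\}$. Let $H_0$ be the harmonic oscillator, i.e. the closure in $L^2(\mathbb R^2)$ of $-\Delta+|x|^2$ on $C_0^\infty(\mathbb R^2)$. For $\beta,\theta\in\mathbb C$ let $$H(\beta,\theta)=-e^{-2\theta}\Delta+e^{2\theta}|x|^2+\beta e^{3\theta}V$$ be the operator sum in $L^2(\mathbb R^2)$, where $\Delta$ is the distributional Laplacian with domain $\{u\in L^2:\Delta u\in L^2\}$, $|x|^2$ is the maximal multiplication operator, and the domain of the sum is the intersection of the domains of the three summands. Let $$P=\{(s,t)\in\mathbb R^2:\ 0<t+s<\pi,\ 0<5t+s<\pi\}$$ and let $\Omega$ be the set of all $(\beta,\theta)\in\mathbb C^2$ such that $\beta\neq 0$ and $(s,\operatorname{Im}\theta)\in P$ for some determination $s$ of $\arg\beta$ (that is, some $s\in\mathbb R$ with $\beta=|\beta|e^{is}$). Then $H(\beta,\theta)$, $(\beta,\theta)\in\Omega$,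 is a holomorphic family of type A of closed operators with domain $D(H_0)\cap D(V)$: the set $\Omega$ is open and connected; for every $(\beta,\theta)\in\Omega$ the operator $H(\beta,\theta)$ is closed and its domain is $D(H_0)\cap D(V)$; and for every $u\in D(H_0)\cap D(V)$ the map $(\beta,\theta)\mapsto H(\beta,\theta)u$ is holomorphic from $\Omega$ to $L^2(\mathbb R^2)$. Moreover, for every $(\beta,\theta)\in\Omega$, $H(\beta,\theta)$ has compact resolvents: its resolvent set is non-empty, and $(z-H(\beta,\theta))^{-1}$ is compact for every $z$ in the resolvent set. -/

import Mathlib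

open MeasureTheory
open scoped ENNReal SchwartzMap ContDiff Laplacian

noncomputable section

namespace HenonHeiles

/-- The plane `ℝ²` with its Euclidean norm. -/
abbrev Plane : Type := EuclideanSpace ℝ (Fin 2)

/-- The Hilbert space `L²(ℝ²)` of complex-valued functions. -/
abbrev L2 : Type := Lp ℂ 2 (volume : Measure Plane)

/-- The maximal domain `{u ∈ L² | v u ∈ L²}` of multiplication by a real function `v`. -/
def mulDomain (v : Plane → ℝ) : Submodule ℂ L2 where
  carrier := {u | MemLp (fun x => (v x : ℂ) * u x) 2 volume}
  zero_mem' := by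
    refine (MemLp.zero (ε := ℂ)).ae_eq ?_
    filter_upwards [Lp.coeFn_zero ℂ 2 (volume : Measure Plane)] with x hx
    rw [hx, Pi.zero_apply, mul_zero]
  add_mem' := by
    intro a b ha hb
    refine (MemLp.add ha hb).ae_eq ?_
    filter_upwards [Lp.coeFn_add a b] with x hx
    rw [hx, Pi.add_apply, Pi.add_apply, mul_add]
  smul_mem' := by
    intro c a ha
    refine (MemLp.const_smul ha c).ae_eq ?_
    filter_upwards [Lp.coeFn_smul c a] with x hx
    rw [hx, Pi.smul_apply, Pi.smul_apply, smul_eq_mul, smul_eq_mul, mul_left_comm]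

theorem memLp_of_mem_mulDomain {v : Plane → ℝ} {u : L2} (hu : u ∈ mulDomain v) :
    MemLp (fun x => (v x : ℂ) * u x) 2 volume := hu

/-- The maximal operator `u ↦ v u` of multiplication by a real function `v` in `L²(ℝ²)`. -/
def mulOp (v : Plane → ℝ) : L2 →ₗ.[ℂ] L2 where
  domain := mulDomain v
  toFun :=
    { toFun := fun u => (memLp_of_mem_mulDomain u.2).toLp (fun x => (v x : ℂ) * (u : L2) x)
      map_add' := by
        intro a b
        apply Lp.ext
        filter_upwards [Lp.coeFn_add (a : L2) (b : L2),
          (memLp_of_mem_mulDomain (a + b).2).coeFn_toLp,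
          (memLp_of_mem_mulDomain a.2).coeFn_toLp, (memLp_of_mem_mulDomain b.2).coeFn_toLp,
          Lp.coeFn_add ((memLp_of_mem_mulDomain a.2).toLp _)
            ((memLp_of_mem_mulDomain b.2).toLp _)] with x h1 h2 h3 h4 h5
        rw [h2, h5, Pi.add_apply, h3, h4, Submodule.coe_add, h1, Pi.add_apply, mul_add]
      map_smul' := by
        intro c a
        apply Lp.ext
        filter_upwards [Lp.coeFn_smul c (a : L2),
          (memLp_of_mem_mulDomain (c • a).2).coeFn_toLp,
          (memLp_of_mem_mulDomain a.2).coeFn_toLp,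
          Lp.coeFn_smul c ((memLp_of_mem_mulDomain a.2).toLp _)] with x h1 h2 h3 h4
        rw [RingHom.id_apply, h2, h4, Pi.smul_apply, h3, Submodule.coe_smul, h1, Pi.smul_apply,
          smul_eq_mul, smul_eq_mul, mul_left_comm] }

/-- The pairs `(u, f)` of `L²` functions with `Δ u = f` in the sense of (tempered)
distributions. -/
def laplacianGraph : Submodule ℂ (L2 × L2) where
  carrier := {p | Δ (p.1 : 𝓢'(Plane, ℂ)) = (p.2 : 𝓢'(Plane, ℂ))}
  zero_mem' := by
    ext φ
    simp [← Lp.toTemperedDistributionCLM_apply]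
  add_mem' := by
    intro a b ha hb
    simp only [Set.mem_ofPred_eq, ← Lp.toTemperedDistributionCLM_apply,
      ← TemperedDistribution.laplacianCLM_apply, Prod.fst_add, Prod.snd_add, map_add] at *
    rw [ha, hb]
  smul_mem' := by
    intro c a ha
    simp only [Set.mem_ofPred_eq, ← Lp.toTemperedDistributionCLM_apply,
      ← TemperedDistribution.laplacianCLM_apply, Prod.smul_fst, Prod.smul_snd, map_smul] at *
    rw [ha]

/-- The Laplace operator in `L²(ℝ²)`, with domain `{u ∈ L² | Δ u ∈ L²}`. -/
def laplaceOp : L2 →ₗ.[ℂ] L2 := laplacianGraph.toLinearPMap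

/-- `laplacianGraph` is the graph of a function, so that `laplaceOp` has it as its graph. -/
theorem laplaceOp_graph : laplaceOp.graph = laplacianGraph := by
  refine Submodule.toLinearPMap_graph_eq _ ?_
  intro p hp h0
  have hp' : Δ (p.1 : 𝓢'(Plane, ℂ)) = (p.2 : 𝓢'(Plane, ℂ)) := hp
  rw [h0, ← Lp.toTemperedDistributionCLM_apply, ← TemperedDistribution.laplacianCLM_apply,
    map_zero, map_zero, ← Lp.toTemperedDistributionCLM_apply] at hp'
  have hk := Lp.ker_toTemperedDistributionCLM_eq_bot (F := ℂ) (μ := (volume : Measure Plane))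
    (p := 2)
  rw [LinearMap.ker_eq_bot'] at hk
  exact hk _ hp'.symm

/-- `C₀^∞(ℝ²)` as a subspace of `L²(ℝ²)`. -/
def testFunctions : Submodule ℂ L2 where
  carrier := {u | ∃ φ : Plane → ℂ, ContDiff ℝ ∞ φ ∧ HasCompactSupport φ ∧ u =ᵐ[volume] φ}
  zero_mem' := ⟨0, contDiff_const, HasCompactSupport.zero, Lp.coeFn_zero _ _ _⟩
  add_mem' := by
    rintro a b ⟨φ, hφ, hφ', ha⟩ ⟨ψ, hψ, hψ', hb⟩
    exact ⟨φ + ψ, hφ.add hψ, hφ'.add hψ', (Lp.coeFn_add a b).trans (ha.add hb)⟩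
  smul_mem' := by
    rintro c a ⟨φ, hφ, hφ', ha⟩
    exact ⟨c • φ, hφ.const_smul c, hφ'.smul_left (f := fun _ => c),
      (Lp.coeFn_smul c a).trans (ha.const_smul c)⟩

/-- The harmonic oscillator `H₀ = -Δ + x²`: the closure in `L²(ℝ²)` of the differential operator
on `C₀^∞(ℝ²)`. -/
def harmonicOscillator : L2 →ₗ.[ℂ] L2 :=
  ((-laplaceOp + mulOp (fun x => ‖x‖ ^ 2)).domRestrict testFunctions).closure

/-- The Hénon–Heiles potential `V(x) = x₁² x₂ - x₂³ / 3`. -/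
def potential (x : Plane) : ℝ := x 0 ^ 2 * x 1 - x 1 ^ 3 / 3

/-- The operator `H(β, θ) = -e^{-2θ} Δ + e^{2θ} x² + β e^{3θ} V` in `L²(ℝ²)`, as a sum of
unbounded operators (its domain is the intersection of the domains of the three summands). -/
def dilatedH (β θ : ℂ) : L2 →ₗ.[ℂ] L2 :=
  (-Complex.exp (-2 * θ)) • laplaceOp + Complex.exp (2 * θ) • mulOp (fun x => ‖x‖ ^ 2)
    + (β * Complex.exp (3 * θ)) • mulOp potential

/-- The parallelogram `P` of the `(s, t)`-plane. -/
def parallelogram : Set (ℝ × ℝ) :=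
  {p | 0 < p.2 + p.1 ∧ p.2 + p.1 < Real.pi ∧ 0 < 5 * p.2 + p.1 ∧ 5 * p.2 + p.1 < Real.pi}

/-- The pairs `(β, θ)`, `β ≠ 0`, such that `(s, Im θ) ∈ P` for some determination `s` of
`arg β`. In `P` the coordinate `s` ranges over `(-π/4, 5π/4)`, so the principal determination would
not do; as this interval is shorter than `2π`, the suitable `s` is unique. -/
def parameterRegion : Set (ℂ × ℂ) :=
  {p | p.1 ≠ 0 ∧ ∃ s : ℝ, p.1 = ‖p.1‖ * Complex.exp (s * Complex.I) ∧
    (s, p.2.im) ∈ parallelogram}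

/-- A holomorphic family of type (A) of closed operators with common domain `D`: the parameter
varies in a domain (open connected set) `Ω` of a complex normed space, every `T p` is closed with
domain `D`, and `p ↦ T p u` is holomorphic in `Ω` for every `u ∈ D`. -/
structure IsHolomorphicFamilyTypeA {P E F : Type*} [NormedAddCommGroup P] [NormedSpace ℂ P]
    [NormedAddCommGroup E] [NormedSpace ℂ E] [NormedAddCommGroup F] [NormedSpace ℂ F]
    (Ω : Set P) (T : P → E →ₗ.[ℂ] F) (D : Submodule ℂ E) : Prop where
  isOpen : IsOpen Ω
  isConnected : IsConnected Ω
  isClosed : ∀ p ∈ Ω, (T p).IsClosed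
  domain_eq : ∀ p ∈ Ω, (T p).domain = D
  holomorphic : ∀ u ∈ D, ∃ f : P → F, DifferentiableOn ℂ f Ω ∧ ∀ p ∈ Ω, (u, f p) ∈ (T p).graph

/-- The bounded operator `R` is the resolvent `(z - T)⁻¹` of `T` at `z`. -/
def IsResolventAt {E : Type*} [NormedAddCommGroup E] [NormedSpace ℂ E]
    (T : E →ₗ.[ℂ] E) (z : ℂ) (R : E →L[ℂ] E) : Prop :=
  (∀ f : E, ∃ h : R f ∈ T.domain, z • R f - T ⟨R f, h⟩ = f) ∧
    ∀ u : T.domain, R (z • (u : E) - T u) = u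

/-- `T` has compact resolvents: its resolvent set is non-empty, and its resolvent at every point
of the resolvent set is a compact operator. -/
def HasCompactResolvents {E : Type*} [NormedAddCommGroup E] [NormedSpace ℂ E]
    (T : E →ₗ.[ℂ] E) : Prop :=
  (∃ (z : ℂ) (R : E →L[ℂ] E), IsResolventAt T z R) ∧
    ∀ (z : ℂ) (R : E →L[ℂ] E), IsResolventAt T z R → IsCompactOperator R

end HenonHeiles

end

noncomputable section

namespace HenonHeiles

/-! ### Polynomials times a Gaussian as Schwartz functions -/

section

open scoped LineDeriv

/-! Put b = β e^{5θ} and c = e^{-2θ}, so that H = c(-Δ + e^{4θ}|x|² + bV). With t = Im θ, the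
arguments of b and e^{4θ} are 5t + s and 4t. Thus 0 < 5t + s < π means Im b > 0, and 0 < t + s < π
then lets one write e^{4θ} = τ² + κb with τ > 0 and κ real (`exists_parameters`). Hence c⁻¹H = S +
bW, where S = -Δ + τ²|x|² is nonnegative and W = V + κ|x|² is a real cubic polynomial.

Uniqueness for S + l + bW, l ≥ 1, is a numerical range estimate: after division by b the W-term is
real, and the imaginary part only sees S + l (`norm_oscResolvent_le_of_eq`). Existence
(`exists_solution`) is sought as u = (1 + S)⁻¹y and follows from a lower bound for the adjoint
problem. There the W-term contributes only the commutator of S and W, that is, ∇p and ∇W. Since ∇W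
is quadratic, it is controlled by 1 + S (`norm_sq_oscPoly_ge`), and a large l absorbs the rest.

One resolvent point makes H closed on exactly D(Δ) ∩ D(|x|²) ∩ D(V). Resolvents of H have range
inside that of the injective compact operator (1 + S)⁻¹, hence are compact.

The oscillator is handled on polynomials times a Gaussian, where 1 + S is triangular with respect to
degree, with diagonal tending to infinity; this gives surjectivity on polynomials and compactness of
(1 + S)⁻¹ (`isCompactOperator_of_flag`). Such functions determine L² functions by their moments, so
identities tested on them become identities almost everywhere (`polyEval_mul_ae_eq_of_integral_eq`).
They are also limits in graph norm of test functions, which identifies D(H₀) with D(Δ) ∩ D(|x|²)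
(`harmonicOscillator_graph`). -/

theorem hasTemperateGrowth_fderiv {E F : Type*} [NormedAddCommGroup E] [NormedSpace ℝ E]
    [NormedAddCommGroup F] [NormedSpace ℝ F] {q : E → F} (hq : q.HasTemperateGrowth) :
    (fderiv ℝ q).HasTemperateGrowth := by
  refine ⟨(contDiff_infty_iff_fderiv.mp hq.1).2, fun n => ?_⟩
  obtain ⟨k, C, h⟩ := hq.2 (n + 1)
  exact ⟨k, C, fun x => by simpa only [norm_iteratedFDeriv_fderiv] using h x⟩

theorem one_add_pow_mul_exp_neg_sq_le {c : ℝ} (hc : 0 < c) (N : ℕ) :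
    ∃ C : ℝ, 0 ≤ C ∧ ∀ r : ℝ, 0 ≤ r → (1 + r) ^ N * Real.exp (-c * r ^ 2) ≤ C := by
  refine ⟨N.factorial * Real.exp (1 + 1 / (4 * c)), by positivity, fun r hr => ?_⟩
  have h1 : (1 + r) ^ N ≤ N.factorial * Real.exp (1 + r) := by
    have := Real.pow_div_factorial_le_exp (1 + r) (by positivity) N
    rwa [div_le_iff₀' (by positivity)] at this
  calc (1 + r) ^ N * Real.exp (-c * r ^ 2)
      ≤ N.factorial * Real.exp (1 + r) * Real.exp (-c * r ^ 2) := by gcongr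
    _ = N.factorial * Real.exp (1 + r + -c * r ^ 2) := by rw [mul_assoc, ← Real.exp_add]
    _ ≤ _ := by
      refine mul_le_mul_of_nonneg_left (Real.exp_le_exp.mpr ?_) (by positivity)
      have : 0 ≤ (2 * c * r - 1) ^ 2 / (4 * c) := by positivity
      have h2 : (2 * c * r - 1) ^ 2 / (4 * c) = c * r ^ 2 - r + 1 / (4 * c) := by
        field_simp; ring
      linarith

/-- The Gaussian `exp (-τ |x|² / 2)`. -/
def gauss (τ : ℝ) (x : Plane) : ℝ := Real.exp (-(τ / 2) * ‖x‖ ^ 2)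

theorem gauss_pos (τ : ℝ) (x : Plane) : 0 < gauss τ x := Real.exp_pos _

theorem hasFDerivAt_gauss (τ : ℝ) (x : Plane) :
    HasFDerivAt (gauss τ) ((-τ * gauss τ x) • innerSL ℝ x) x := by
  have h := ((hasStrictFDerivAt_norm_sq x).hasFDerivAt.const_mul (-(τ / 2))).exp
  refine h.congr_fderiv ?_
  ext v
  simp [gauss]
  ring

theorem contDiff_gauss (τ : ℝ) {n : WithTop ℕ∞} : ContDiff ℝ n (gauss τ) :=
  (contDiff_const.mul (contDiff_norm_sq ℝ)).exp

/-- Differentiating a Gaussian times q gives the same Gaussian times another factor of temperate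
growth, so the order of derivative drops by induction. The target space must vary, since the new
factor takes values in linear maps. -/
theorem gauss_smul_decay {τ : ℝ} (hτ : 0 < τ) (k n : ℕ) {F : Type} [NormedAddCommGroup F]
    [NormedSpace ℝ F] {q : Plane → F} (hq : q.HasTemperateGrowth) :
    ∃ C, ∀ x, ‖x‖ ^ k * ‖iteratedFDeriv ℝ n (fun x => gauss τ x • q x) x‖ ≤ C := by
  induction n generalizing F with
  | zero =>
    obtain ⟨m, C, h⟩ := hq.2 0
    obtain ⟨C', hC', h'⟩ := one_add_pow_mul_exp_neg_sq_le (c := τ / 2) (by positivity) (k + m)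
    have hC : 0 ≤ C := by simpa using (norm_nonneg _).trans (h 0)
    refine ⟨C * C', fun x => ?_⟩
    rw [norm_iteratedFDeriv_zero, norm_smul, Real.norm_of_nonneg (gauss_pos _ _).le]
    have h0 := h x
    rw [norm_iteratedFDeriv_zero] at h0
    have hx : ‖x‖ ^ k ≤ (1 + ‖x‖) ^ k := by gcongr; linarith
    have hg := gauss_pos τ x
    calc ‖x‖ ^ k * (gauss τ x * ‖q x‖)
        ≤ (1 + ‖x‖) ^ k * (gauss τ x * (C * (1 + ‖x‖) ^ m)) := by gcongr
      _ = C * ((1 + ‖x‖) ^ (k + m) * gauss τ x) := by ring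
      _ ≤ C * C' := by gcongr; exact h' _ (norm_nonneg x)
  | succ n ih =>
    have hfd : fderiv ℝ (fun x => gauss τ x • q x) = fun x => gauss τ x •
        (fderiv ℝ q x + (-τ) • (innerSL ℝ x).smulRight (q x)) := by
      funext x
      have := (hasFDerivAt_gauss τ x).smul
        ((hq.1.differentiable (by simp)) x).hasFDerivAt
      rw [HasFDerivAt.fderiv (f := fun x => gauss τ x • q x) this]
      ext v
      simp [smul_smul, mul_comm, mul_assoc]
    have hq' : Function.HasTemperateGrowth
        (fun x => fderiv ℝ q x + (-τ) • (innerSL ℝ x).smulRight (q x)) := by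
      have h1 := (ContinuousLinearMap.smulRightL ℝ Plane F).bilinear_hasTemperateGrowth
        (innerSL ℝ : Plane →L[ℝ] _).hasTemperateGrowth hq
      exact (hasTemperateGrowth_fderiv hq).add ((Function.HasTemperateGrowth.const (-τ)).smul h1)
    obtain ⟨C, hC⟩ := ih hq'
    refine ⟨C, fun x => ?_⟩
    rw [← norm_iteratedFDeriv_fderiv, hfd]
    exact hC x

/-- A function of temperate growth times a Gaussian is a Schwartz function. -/
def gaussSchwartz {τ : ℝ} (hτ : 0 < τ) {F : Type} [NormedAddCommGroup F]
    [NormedSpace ℝ F] {q : Plane → F} (hq : q.HasTemperateGrowth) : 𝓢(Plane, F) where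
  toFun x := gauss τ x • q x
  smooth' := (contDiff_gauss τ).smul hq.1
  decay' k n := gauss_smul_decay hτ k n hq

/-- Complex polynomials in two variables. -/
abbrev Poly : Type := MvPolynomial (Fin 2) ℂ

/-- Evaluation of a polynomial at a point of the real plane. -/
def polyEval (p : Poly) (x : Plane) : ℂ := MvPolynomial.aeval (fun i => (x i : ℂ)) p

theorem hasFDerivAt_coord (i : Fin 2) (x : Plane) :
    HasFDerivAt (fun x : Plane => (x i : ℂ))
      (Complex.ofRealCLM ∘L (EuclideanSpace.proj i : Plane →L[ℝ] ℝ)) x :=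
  (Complex.ofRealCLM ∘L (EuclideanSpace.proj i : Plane →L[ℝ] ℝ)).hasFDerivAt

theorem polyEval_C (a : ℂ) : polyEval (MvPolynomial.C a) = fun _ => a := by
  funext x; simp [polyEval]

theorem polyEval_add (p q : Poly) : polyEval (p + q) = fun x => polyEval p x + polyEval q x := by
  funext x; simp [polyEval]

theorem polyEval_mul (p q : Poly) : polyEval (p * q) = fun x => polyEval p x * polyEval q x := by
  funext x; simp [polyEval]

theorem polyEval_X (i : Fin 2) : polyEval (MvPolynomial.X i) = fun x => (x i : ℂ) := by
  funext x; simp [polyEval]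

theorem hasTemperateGrowth_polyEval (p : Poly) : (polyEval p).HasTemperateGrowth := by
  induction p using MvPolynomial.induction_on with
  | C a => rw [polyEval_C]; exact .const a
  | add p q hp hq => rw [polyEval_add]; exact hp.add hq
  | mul_X p i hp =>
    rw [polyEval_mul, polyEval_X]
    exact hp.mul
      (Complex.ofRealCLM ∘L (EuclideanSpace.proj i : Plane →L[ℝ] ℝ)).hasTemperateGrowth

theorem hasFDerivAt_polyEval (p : Poly) (x : Plane) :
    HasFDerivAt (polyEval p) (∑ j, polyEval (MvPolynomial.pderiv j p) x •
      (Complex.ofRealCLM ∘L (EuclideanSpace.proj j : Plane →L[ℝ] ℝ))) x := by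
  induction p using MvPolynomial.induction_on with
  | C a =>
    rw [polyEval_C]
    refine (hasFDerivAt_const a x).congr_fderiv ?_
    ext v
    simp [polyEval]
  | add p q hp hq =>
    rw [polyEval_add]
    refine (hp.add hq).congr_fderiv ?_
    ext v
    simp [polyEval]
    ring
  | mul_X p i hp =>
    rw [polyEval_mul, polyEval_X]
    refine (hp.mul (hasFDerivAt_coord i x)).congr_fderiv ?_
    ext v
    fin_cases i <;> simp [polyEval, MvPolynomial.pderiv_X] <;> ring

variable {τ : ℝ}

/-- The Schwartz function `p(x) exp (-τ |x|² / 2)`. -/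
def polyGauss (hτ : 0 < τ) : Poly →ₗ[ℂ] 𝓢(Plane, ℂ) where
  toFun p := gaussSchwartz hτ (hasTemperateGrowth_polyEval p)
  map_add' p q := by
    ext x
    change gauss τ x • polyEval (p + q) x = gauss τ x • polyEval p x + gauss τ x • polyEval q x
    simp [polyEval]
  map_smul' c p := by
    ext x
    change gauss τ x • polyEval (c • p) x = c • (gauss τ x • polyEval p x)
    simp [polyEval, mul_left_comm]

theorem polyGauss_apply (hτ : 0 < τ) (p : Poly) (x : Plane) :
    polyGauss hτ p x = gauss τ x * polyEval p x := by
  change gauss τ x • polyEval p x = _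
  simp

/-- The operator on polynomials corresponding to `∂ / ∂ x_j` on polynomials times Gaussian. -/
def gaussDeriv (τ : ℝ) (j : Fin 2) : Poly →ₗ[ℂ] Poly :=
  (MvPolynomial.pderiv j).toLinearMap -
    LinearMap.mulLeft ℂ (MvPolynomial.C (τ : ℂ) * MvPolynomial.X j)

theorem gaussDeriv_apply (τ : ℝ) (j : Fin 2) (p : Poly) :
    gaussDeriv τ j p = MvPolynomial.pderiv j p - MvPolynomial.C (τ : ℂ) * MvPolynomial.X j * p := rfl

theorem lineDeriv_polyGauss (hτ : 0 < τ) (j : Fin 2) (p : Poly) :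
    ∂_{EuclideanSpace.single j (1 : ℝ)} (polyGauss hτ p) = polyGauss hτ (gaussDeriv τ j p) := by
  ext x
  have h : HasFDerivAt (polyGauss hτ p) _ x :=
    (hasFDerivAt_gauss τ x).smul (hasFDerivAt_polyEval p x)
  rw [SchwartzMap.lineDerivOp_apply_eq_fderiv, h.fderiv, polyGauss_apply, gaussDeriv_apply]
  fin_cases j <;> simp [polyEval, EuclideanSpace.inner_single_right] <;> ring

theorem laplacian_polyGauss (hτ : 0 < τ) (p : Poly) :
    Δ (polyGauss hτ p) =
      polyGauss hτ (∑ j, gaussDeriv τ j (gaussDeriv τ j p)) := by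
  rw [SchwartzMap.laplacian_eq_sum (EuclideanSpace.basisFun (Fin 2) ℝ)]
  simp only [EuclideanSpace.basisFun_apply, lineDeriv_polyGauss, map_sum]

end

/-! ### Moment determinacy and density in L² -/

section

open scoped LineDeriv

open scoped FourierTransform in
/-- A function with exponential moments of all orders, orthogonal to all polynomials, has zero
Fourier transform. -/
theorem fourier_eq_zero_of_integral_polyEval_eq_zero {g : Plane → ℂ}
    (hg : ∀ r : ℝ, Integrable (fun x => (Real.exp (r * ‖x‖) : ℂ) * g x))
    (h : ∀ p : Poly, ∫ x, polyEval p x * g x = 0) (ξ : Plane) : 𝓕 g ξ = 0 := by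
  have hgi : Integrable g := by simpa using hg 0
  let R : ℝ := 2 * Real.pi * ‖ξ‖
  let c : Plane → ℂ := fun x => ((-2 * Real.pi * inner ℝ x ξ : ℝ) : ℂ) * Complex.I
  have hc : Continuous c := by fun_prop
  have hcR : ∀ x, ‖c x‖ ≤ R * ‖x‖ := fun x => by
    have h1 := abs_real_inner_le_norm x ξ
    simp only [c, R, norm_mul, Complex.norm_I, mul_one, Complex.norm_real, Real.norm_eq_abs,
      abs_neg, Nat.abs_ofNat, abs_of_pos Real.pi_pos]
    nlinarith [Real.pi_pos]
  have hexp : ∀ y : ℝ, HasSum (fun n : ℕ => y ^ n / n.factorial) (Real.exp y) := fun y => by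
    rw [Real.exp_eq_exp_ℝ]; exact NormedSpace.expSeries_div_hasSum_exp y
  -- The Fourier kernel exp(c(x)) is expanded in powers of the linear form c and integrated term by
  -- term, with majorant e^{R|x|}|g|; each term is a moment of g.
  have key := hasSum_integral_of_dominated_convergence (μ := (volume : Measure Plane))
    (F := fun (n : ℕ) x => c x ^ n / n.factorial * g x)
    (f := fun x => Complex.exp (c x) * g x)
    (fun (n : ℕ) x => (R * ‖x‖) ^ n / n.factorial * ‖g x‖)
    (fun n => (by fun_prop : Continuous fun x => c x ^ n / (n.factorial : ℂ)).aestronglyMeasurable.mul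
      hgi.aestronglyMeasurable)
    (fun n => .of_forall fun x => by
      rw [norm_mul, norm_div, norm_pow]
      have := hcR x
      simp only [Complex.norm_natCast]
      gcongr)
    (.of_forall fun x => ((hexp (R * ‖x‖)).mul_right ‖g x‖).summable)
    (by
      refine (hg R).norm.congr (.of_forall fun x => ?_)
      simp only [norm_mul, Complex.norm_real, Real.norm_eq_abs, Real.abs_exp]
      exact (((hexp (R * ‖x‖)).mul_right ‖g x‖).tsum_eq).symm)
    (.of_forall fun x => by
      refine HasSum.mul_right _ ?_
      rw [Complex.exp_eq_exp_ℂ]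
      exact NormedSpace.expSeries_div_hasSum_exp (c x))
  have hz : ∀ n : ℕ, ∫ x, c x ^ n / n.factorial * g x = 0 := fun n => by
    rw [← h (MvPolynomial.C (1 / (n.factorial : ℂ)) *
      (MvPolynomial.C (-2 * Real.pi * ξ 0 * Complex.I) * MvPolynomial.X 0 +
        MvPolynomial.C (-2 * Real.pi * ξ 1 * Complex.I) * MvPolynomial.X 1) ^ n)]
    refine integral_congr_ae (.of_forall fun x => ?_)
    have : c x = -2 * Real.pi * ξ 0 * Complex.I * x 0 + -2 * Real.pi * ξ 1 * Complex.I * x 1 := by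
      simp only [c, PiLp.inner_apply, Fin.sum_univ_two]
      simp
      ring
    simp only [polyEval, this, map_mul, map_pow, map_add, MvPolynomial.aeval_X,
      MvPolynomial.aeval_C, Algebra.algebraMap_self_apply]
    ring
  rw [Real.fourier_eq']
  simp only [hz] at key
  exact key.unique hasSum_zero

open scoped FourierTransform in
-- Every test function is the Fourier transform of a Schwartz function, and the transform moves
-- across the integral onto g.
theorem ae_eq_zero_of_fourier_eq_zero {g : Plane → ℂ} (hg : Integrable g)
    (h : ∀ ξ, 𝓕 g ξ = 0) : g =ᵐ[volume] 0 := by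
  refine ae_eq_zero_of_integral_contDiff_smul_eq_zero hg.locallyIntegrable fun ψ hψ hψ' => ?_
  have h1 : HasCompactSupport (Complex.ofRealCLM ∘ ψ) := hψ'.comp_left rfl
  have h2 : ContDiff ℝ ∞ (Complex.ofRealCLM ∘ ψ) := by fun_prop
  let Ψ : 𝓢(Plane, ℂ) := h1.toSchwartzMap h2
  have key := VectorFourier.integral_fourierIntegral_smul_eq_flip (L := innerₗ Plane)
    (μ := volume) (ν := volume) Real.continuous_fourierChar continuous_inner hg
    (𝓕⁻ Ψ : 𝓢(Plane, ℂ)).integrable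
  have h3 : ∀ x, VectorFourier.fourierIntegral Real.fourierChar volume (innerₗ Plane).flip
      (⇑(𝓕⁻ Ψ : 𝓢(Plane, ℂ))) x = Ψ x := by
    intro x
    have : 𝓕 (𝓕⁻ Ψ) = Ψ := FourierTransform.fourier_fourierInv_eq Ψ
    have h4 := DFunLike.congr_fun this x
    rw [SchwartzMap.fourier_coe] at h4
    rw [flip_innerₗ]
    exact h4
  have h5 : ∀ ξ, VectorFourier.fourierIntegral Real.fourierChar volume (innerₗ Plane) g ξ = 0 := h
  simp only [h3, h5, zero_smul, integral_zero] at key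
  rw [key]
  refine integral_congr_ae (.of_forall fun x => ?_)
  change ψ x • g x = g x • ((ψ x : ℝ) : ℂ)
  simp [mul_comm]

variable {τ : ℝ}

/-- Half of the Gaussian exponent absorbs e^{r|x|}: completing the square, r|x| - τ|x|²/4 ≤ r²/τ. -/
theorem memLp_exp_mul_polyGauss (hτ : 0 < τ) (r : ℝ) (p : Poly) :
    MemLp (fun x => (Real.exp (r * ‖x‖) : ℂ) * polyGauss hτ p x) 2 volume := by
  have hτ2 : 0 < τ / 2 := by positivity
  have h := (polyGauss hτ2 p).memLp 2
  refine (h.const_mul (Real.exp (r ^ 2 / τ) : ℂ)).of_le ?_ (.of_forall fun x => ?_)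
  · exact ((by fun_prop : Continuous fun x : Plane => (Real.exp (r * ‖x‖) : ℂ)).mul
      (polyGauss hτ p).continuous).aestronglyMeasurable
  · simp only [polyGauss_apply, norm_mul, Complex.norm_real, Real.norm_eq_abs, Real.abs_exp, gauss]
    rw [← mul_assoc, ← mul_assoc, ← Real.exp_add, ← Real.exp_add]
    refine mul_le_mul_of_nonneg_right (Real.exp_le_exp.mpr ?_) (norm_nonneg _)
    have : 0 ≤ (τ * ‖x‖ - 2 * r) ^ 2 / (4 * τ) := by positivity
    have h2 : (τ * ‖x‖ - 2 * r) ^ 2 / (4 * τ) = τ * ‖x‖ ^ 2 / 4 - r * ‖x‖ + r ^ 2 / τ := by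
      field_simp; ring
    linarith

/-- If `w` is a polynomial and `u`, `f` are square integrable, and `w u - f` is orthogonal to all
polynomials times Gaussian, then `w u = f`. -/
theorem polyEval_mul_ae_eq_of_integral_eq (hτ : 0 < τ) (w : Poly) (u f : L2)
    (h : ∀ p, ∫ x, polyGauss hτ (w * p) x * u x = ∫ x, polyGauss hτ p x * f x) :
    (fun x => polyEval w x * u x) =ᵐ[volume] f := by
  have hi : ∀ (r : ℝ) (p : Poly) (v : L2),
      Integrable (fun x => ((Real.exp (r * ‖x‖) : ℂ) * polyGauss hτ p x) * v x) := fun r p v =>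
    (memLp_exp_mul_polyGauss hτ r p).integrable_mul (Lp.memLp v)
  have hi0 : ∀ (p : Poly) (v : L2), Integrable (fun x => polyGauss hτ p x * v x) := fun p v => by
    simpa using hi 0 p v
  -- This is the Gaussian times wu - f: the Gaussian weight supplies all exponential moments even
  -- though wu need not be integrable.
  let g : Plane → ℂ := fun x => polyGauss hτ w x * u x - polyGauss hτ 1 x * f x
  have hg : g =ᵐ[volume] 0 := by
    have hgi : ∀ r : ℝ, Integrable (fun x => (Real.exp (r * ‖x‖) : ℂ) * g x) := fun r => by
      refine ((hi r w u).sub (hi r 1 f)).congr (.of_forall fun x => ?_)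
      simp only [g, Pi.sub_apply]
      ring
    refine ae_eq_zero_of_fourier_eq_zero (by simpa using hgi 0)
      (fourier_eq_zero_of_integral_polyEval_eq_zero hgi fun p => ?_)
    have h1 : ∀ x, polyEval p x * g x =
        polyGauss hτ (w * p) x * u x - polyGauss hτ p x * f x := fun x => by
      simp only [g, polyGauss_apply, polyEval_mul]
      simp only [polyEval, map_one]
      ring
    simp only [h1]
    rw [integral_sub (hi0 _ _) (hi0 _ _), h, sub_self]
  filter_upwards [hg] with x hx
  have h0 : (gauss τ x : ℂ) ≠ 0 := by exact_mod_cast (gauss_pos τ x).ne'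
  simp only [g, polyGauss_apply, Pi.zero_apply] at hx
  simp only [polyEval, map_one] at hx ⊢
  refine mul_left_cancel₀ h0 ?_
  linear_combination hx

theorem polyEval_map_conj (p : Poly) (x : Plane) :
    polyEval (MvPolynomial.map (starRingEnd ℂ) p) x = starRingEnd ℂ (polyEval p x) := by
  induction p using MvPolynomial.induction_on with
  | C a => simp [polyEval]
  | add p q hp hq => simp_all [polyEval]
  | mul_X p i hp => simp_all [polyEval]

/-- The embedding `p ↦ p(x) exp (-τ |x|² / 2)` of polynomials into `L²`. -/
def hermite (hτ : 0 < τ) : Poly →ₗ[ℂ] L2 :=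
  (SchwartzMap.toLpCLM ℂ ℂ 2 volume).toLinearMap ∘ₗ polyGauss hτ

theorem hermite_apply (hτ : 0 < τ) (p : Poly) : hermite hτ p = (polyGauss hτ p).toLp 2 := rfl

theorem coeFn_hermite (hτ : 0 < τ) (p : Poly) :
    hermite hτ p =ᵐ[volume] polyGauss hτ p := SchwartzMap.coeFn_toLp _ 2 _

theorem inner_hermite (hτ : 0 < τ) (p : Poly) (u : L2) :
    inner ℂ (hermite hτ p) u =
      ∫ x, polyGauss hτ (MvPolynomial.map (starRingEnd ℂ) p) x * u x := by
  rw [L2.inner_def]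
  refine integral_congr_ae ?_
  filter_upwards [coeFn_hermite hτ p] with x hx
  rw [hx, RCLike.inner_apply', polyGauss_apply, polyGauss_apply, polyEval_map_conj]
  simp

theorem map_conj_map_conj (p : Poly) :
    MvPolynomial.map (starRingEnd ℂ) (MvPolynomial.map (starRingEnd ℂ) p) = p := by
  rw [MvPolynomial.map_map]
  have : (starRingEnd ℂ).comp (starRingEnd ℂ) = RingHom.id ℂ := by ext; simp
  rw [this, MvPolynomial.map_id]

/-- `polyEval_mul_ae_eq_of_integral_eq` in terms of the inner product of `L²`. -/
theorem polyEval_mul_ae_eq_of_inner_eq (hτ : 0 < τ) (w : Poly)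
    (hw : MvPolynomial.map (starRingEnd ℂ) w = w) (u f : L2)
    (h : ∀ p, inner ℂ (hermite hτ (w * p)) u = inner ℂ (hermite hτ p) f) :
    (fun x => polyEval w x * u x) =ᵐ[volume] f := by
  refine polyEval_mul_ae_eq_of_integral_eq hτ w u f fun p => ?_
  have := h (MvPolynomial.map (starRingEnd ℂ) p)
  rwa [inner_hermite, inner_hermite, map_mul, hw, map_conj_map_conj] at this

theorem eq_of_inner_hermite_eq (hτ : 0 < τ) (u f : L2)
    (h : ∀ p, inner ℂ (hermite hτ p) u = inner ℂ (hermite hτ p) f) : u = f := by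
  refine Lp.ext ?_
  have := polyEval_mul_ae_eq_of_inner_eq hτ 1 (by simp) u f (by simpa using h)
  filter_upwards [this] with x hx
  simpa [polyEval] using hx

theorem denseRange_hermite (hτ : 0 < τ) : DenseRange (hermite hτ) := by
  have : (LinearMap.range (hermite hτ)).topologicalClosure = ⊤ := by
    rw [Submodule.topologicalClosure_eq_top_iff, Submodule.eq_bot_iff]
    intro u hu
    refine eq_of_inner_hermite_eq hτ u 0 fun p => ?_
    rw [inner_zero_right]
    exact (Submodule.mem_orthogonal _ _).mp hu _ ⟨p, rfl⟩
  have h2 := (Submodule.dense_iff_topologicalClosure_eq_top).mpr this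
  rwa [LinearMap.coe_range] at h2

end

/-! ### Commutation identities and a priori estimates for the oscillator -/

section

open scoped LineDeriv

variable {τ : ℝ}

/-- Polynomials with real coefficients. -/
def IsRealPoly (w : Poly) : Prop := MvPolynomial.map (starRingEnd ℂ) w = w

theorem IsRealPoly.eq {w : Poly} (hw : IsRealPoly w) : MvPolynomial.map (starRingEnd ℂ) w = w := hw

theorem re_inner_self_eq {H : Type*} [NormedAddCommGroup H] [InnerProductSpace ℂ H] (u : H) :
    (inner ℂ u u).re = ‖u‖ ^ 2 := by
  simpa using! inner_self_eq_norm_sq (𝕜 := ℂ) u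

theorem norm_add_sq_eq {H : Type*} [NormedAddCommGroup H] [InnerProductSpace ℂ H] (u v : H) :
    ‖u + v‖ ^ 2 = ‖u‖ ^ 2 + 2 * (inner ℂ u v).re + ‖v‖ ^ 2 := by
  simpa using! norm_add_sq (𝕜 := ℂ) u v

theorem map_conj_gaussDeriv (τ : ℝ) (j : Fin 2) (p : Poly) :
    MvPolynomial.map (starRingEnd ℂ) (gaussDeriv τ j p) =
      gaussDeriv τ j (MvPolynomial.map (starRingEnd ℂ) p) := by
  simp [gaussDeriv_apply, MvPolynomial.pderiv_map]

theorem gaussDeriv_mul (τ : ℝ) (j : Fin 2) (w p : Poly) :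
    gaussDeriv τ j (w * p) = MvPolynomial.pderiv j w * p + w * gaussDeriv τ j p := by
  simp only [gaussDeriv_apply, Derivation.leibniz, smul_eq_mul]
  ring

theorem inner_hermite_hermite (hτ : 0 < τ) (p q : Poly) :
    inner ℂ (hermite hτ p) (hermite hτ q) =
      ∫ x, polyGauss hτ (MvPolynomial.map (starRingEnd ℂ) p) x * polyGauss hτ q x := by
  rw [inner_hermite]
  refine integral_congr_ae ?_
  filter_upwards [coeFn_hermite hτ q] with x hx
  rw [hx]

theorem inner_hermite_mul_left (hτ : 0 < τ) {w : Poly} (hw : IsRealPoly w) (p q : Poly) :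
    inner ℂ (hermite hτ (w * p)) (hermite hτ q) =
      inner ℂ (hermite hτ p) (hermite hτ (w * q)) := by
  rw [inner_hermite_hermite, inner_hermite_hermite]
  refine integral_congr_ae (.of_forall fun x => ?_)
  simp only [polyGauss_apply, map_mul, hw.eq, polyEval_mul]
  ring

theorem inner_hermite_gaussDeriv_left (hτ : 0 < τ) (j : Fin 2) (p q : Poly) :
    inner ℂ (hermite hτ (gaussDeriv τ j p)) (hermite hτ q) =
      -inner ℂ (hermite hτ p) (hermite hτ (gaussDeriv τ j q)) := by
  rw [inner_hermite_hermite, inner_hermite_hermite, map_conj_gaussDeriv, ← lineDeriv_polyGauss,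
    ← lineDeriv_polyGauss, SchwartzMap.integral_mul_lineDerivOp_right_eq_neg_left, neg_neg]

/-- The polynomial `|x|²`. -/
def normSqPoly : Poly := MvPolynomial.X 0 ^ 2 + MvPolynomial.X 1 ^ 2

theorem isRealPoly_X (j : Fin 2) : IsRealPoly (MvPolynomial.X j) := by simp [IsRealPoly]

theorem isRealPoly_normSqPoly : IsRealPoly normSqPoly := by simp [IsRealPoly, normSqPoly]

theorem polyEval_normSqPoly (x : Plane) : polyEval normSqPoly x = (‖x‖ ^ 2 : ℝ) := by
  simp [polyEval, normSqPoly, EuclideanSpace.norm_sq_eq]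

/-- The Laplacian acting on polynomials times Gaussian. -/
def lapPoly (τ : ℝ) : Poly →ₗ[ℂ] Poly := ∑ j, gaussDeriv τ j ∘ₗ gaussDeriv τ j

/-- The operator `-Δ + τ² |x|²` acting on polynomials times Gaussian. -/
def oscPoly (τ : ℝ) : Poly →ₗ[ℂ] Poly :=
  -lapPoly τ + (τ ^ 2 : ℂ) • LinearMap.mulLeft ℂ normSqPoly

theorem lapPoly_apply (τ : ℝ) (p : Poly) :
    lapPoly τ p = gaussDeriv τ 0 (gaussDeriv τ 0 p) + gaussDeriv τ 1 (gaussDeriv τ 1 p) := by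
  simp [lapPoly]

theorem oscPoly_apply (τ : ℝ) (p : Poly) :
    oscPoly τ p = -lapPoly τ p + (τ ^ 2 : ℂ) • (normSqPoly * p) := rfl

theorem inner_lapPoly_left (hτ : 0 < τ) (p q : Poly) :
    inner ℂ (hermite hτ (lapPoly τ p)) (hermite hτ q) =
      -∑ j, inner ℂ (hermite hτ (gaussDeriv τ j p)) (hermite hτ (gaussDeriv τ j q)) := by
  simp only [lapPoly_apply, map_add, inner_add_left, inner_hermite_gaussDeriv_left hτ _ _ q,
    Fin.sum_univ_two, neg_add]

theorem inner_oscPoly_left (hτ : 0 < τ) (p q : Poly) :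
    inner ℂ (hermite hτ (oscPoly τ p)) (hermite hτ q) =
      ∑ j, inner ℂ (hermite hτ (gaussDeriv τ j p)) (hermite hτ (gaussDeriv τ j q)) +
        τ ^ 2 * inner ℂ (hermite hτ p) (hermite hτ (normSqPoly * q)) := by
  rw [oscPoly_apply, map_add, inner_add_left, map_neg, inner_neg_left, inner_lapPoly_left, map_smul,
    inner_smul_left, inner_hermite_mul_left hτ isRealPoly_normSqPoly]
  simp

theorem inner_oscPoly_symm (hτ : 0 < τ) (p q : Poly) :
    inner ℂ (hermite hτ (oscPoly τ p)) (hermite hτ q) =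
      inner ℂ (hermite hτ p) (hermite hτ (oscPoly τ q)) := by
  rw [← inner_conj_symm (hermite hτ p), inner_oscPoly_left, inner_oscPoly_left]
  simp [inner_hermite_mul_left hτ isRealPoly_normSqPoly]

theorem inner_self_mul_real_im (hτ : 0 < τ) {w : Poly} (hw : IsRealPoly w) (p : Poly) :
    (inner ℂ (hermite hτ p) (hermite hτ (w * p))).im = 0 := by
  rw [← Complex.conj_eq_iff_im, inner_conj_symm, inner_hermite_mul_left hτ hw]

theorem inner_self_normSqPoly (hτ : 0 < τ) (p : Poly) :
    inner ℂ (hermite hτ p) (hermite hτ (normSqPoly * p)) =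
      ((∑ j, ‖hermite hτ (MvPolynomial.X j * p)‖ ^ 2 : ℝ) : ℂ) := by
  have : ∀ j, inner ℂ (hermite hτ p) (hermite hτ (MvPolynomial.X j ^ 2 * p)) =
      (‖hermite hτ (MvPolynomial.X j * p)‖ : ℂ) ^ 2 := fun j => by
    rw [pow_two, mul_assoc, ← inner_hermite_mul_left hτ (isRealPoly_X j)]
    exact inner_self_eq_norm_sq_to_K _
  simp [normSqPoly, add_mul, inner_add_right, this]

theorem re_inner_oscPoly_self (hτ : 0 < τ) (p : Poly) :
    (inner ℂ (hermite hτ p) (hermite hτ (oscPoly τ p))).re =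
      ∑ j, ‖hermite hτ (gaussDeriv τ j p)‖ ^ 2 +
        τ ^ 2 * ∑ j, ‖hermite hτ (MvPolynomial.X j * p)‖ ^ 2 := by
  rw [← inner_oscPoly_symm, inner_oscPoly_left, inner_self_normSqPoly]
  simp only [inner_self_eq_norm_sq_to_K]
  norm_cast

/-- The canonical commutation relation: integrating ∂_j by parts reproduces the same term with the
opposite sign, plus -‖p‖². -/
theorem re_inner_gaussDeriv_X (hτ : 0 < τ) (j : Fin 2) (p : Poly) :
    (inner ℂ (hermite hτ (gaussDeriv τ j p)) (hermite hτ (MvPolynomial.X j * p))).re =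
      -(‖hermite hτ p‖ ^ 2 / 2) := by
  have h1 := inner_hermite_gaussDeriv_left hτ j p (MvPolynomial.X j * p)
  rw [gaussDeriv_mul, MvPolynomial.pderiv_X_self, one_mul, map_add, inner_add_right,
    ← inner_hermite_mul_left hτ (isRealPoly_X j) p,
    ← inner_conj_symm (hermite hτ (MvPolynomial.X j * p))] at h1
  have h2 := congrArg Complex.re h1
  simp only [Complex.neg_re, Complex.add_re, Complex.conj_re, re_inner_self_eq] at h2
  linarith

/-- After one integration by parts, derivatives falling on |x|² give ‖p‖² for each of the two
variables, and the remaining terms have a favourable sign. This bounds the cross term in ‖Sp‖². -/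
theorem re_inner_lapPoly_normSqPoly (hτ : 0 < τ) (p : Poly) :
    (inner ℂ (hermite hτ (lapPoly τ p)) (hermite hτ (normSqPoly * p))).re ≤
      2 * ‖hermite hτ p‖ ^ 2 := by
  have hj : ∀ j : Fin 2, (inner ℂ (hermite hτ (gaussDeriv τ j p))
      (hermite hτ (gaussDeriv τ j (normSqPoly * p)))).re ≥ -‖hermite hτ p‖ ^ 2 := by
    intro j
    have h1 : MvPolynomial.pderiv j normSqPoly * p = (2 : ℂ) • (MvPolynomial.X j * p) := by
      rw [MvPolynomial.smul_eq_C_mul, map_ofNat]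
      fin_cases j <;> simp [normSqPoly, Derivation.leibniz_pow, MvPolynomial.pderiv_X] <;> ring
    rw [gaussDeriv_mul, map_add, inner_add_right, h1, map_smul, inner_smul_right,
      inner_self_normSqPoly, Complex.add_re, Complex.ofReal_re]
    have h2 : ((2 : ℂ) * inner ℂ (hermite hτ (gaussDeriv τ j p))
        (hermite hτ (MvPolynomial.X j * p))).re = -‖hermite hτ p‖ ^ 2 := by
      rw [Complex.mul_re, re_inner_gaussDeriv_X]
      simp
      ring
    rw [h2]
    have : 0 ≤ ∑ k, ‖hermite hτ (MvPolynomial.X k * gaussDeriv τ j p)‖ ^ 2 :=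
    Finset.sum_nonneg fun _ _ => sq_nonneg _
    linarith
  rw [inner_lapPoly_left, Fin.sum_univ_two, Complex.neg_re, Complex.add_re]
  linarith [hj 0, hj 1]

/-- Separation: up to a multiple of ‖p‖, S controls its kinetic and potential parts individually, so
that Δ(1 + S)⁻¹ and |x|²(1 + S)⁻¹ will be bounded. -/
theorem norm_sq_oscPoly_ge (hτ : 0 < τ) (p : Poly) :
    ‖hermite hτ (lapPoly τ p)‖ ^ 2 + τ ^ 4 * ‖hermite hτ (normSqPoly * p)‖ ^ 2 ≤
      ‖hermite hτ (oscPoly τ p)‖ ^ 2 + 4 * τ ^ 2 * ‖hermite hτ p‖ ^ 2 := by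
  have h := re_inner_lapPoly_normSqPoly hτ p
  have h1 := norm_sub_sq (𝕜 := ℂ) (hermite hτ ((τ ^ 2 : ℂ) • (normSqPoly * p)))
    (hermite hτ (lapPoly τ p))
  have h2 : hermite hτ (oscPoly τ p) = hermite hτ ((τ ^ 2 : ℂ) • (normSqPoly * p)) -
    hermite hτ (lapPoly τ p) := by rw [oscPoly_apply, map_add, map_neg]; abel
  rw [← h2, map_smul, norm_smul, inner_smul_left] at h1
  have h3 : ‖((τ : ℂ) ^ 2)‖ = τ ^ 2 := by simp
  have h4 : RCLike.re ((starRingEnd ℂ) ((τ : ℂ) ^ 2) * inner ℂ (hermite hτ (normSqPoly * p))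
      (hermite hτ (lapPoly τ p))) =
      τ ^ 2 * (inner ℂ (hermite hτ (lapPoly τ p)) (hermite hτ (normSqPoly * p))).re := by
    rw [← inner_conj_symm, map_pow, Complex.conj_ofReal, ← Complex.ofReal_pow]
    exact (Complex.re_ofReal_mul _ _).trans (by rw [Complex.conj_re])
  rw [h3, h4] at h1
  nlinarith [sq_nonneg τ]

/-- The operator `1 - Δ + τ² |x|²` acting on polynomials times Gaussian. -/
def shiftPoly (τ : ℝ) : Poly →ₗ[ℂ] Poly := oscPoly τ + LinearMap.id

theorem shiftPoly_apply (τ : ℝ) (p : Poly) : shiftPoly τ p = oscPoly τ p + p := rfl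

theorem inner_shiftPoly_symm (hτ : 0 < τ) (p q : Poly) :
    inner ℂ (hermite hτ (shiftPoly τ p)) (hermite hτ q) =
      inner ℂ (hermite hτ p) (hermite hτ (shiftPoly τ q)) := by
  simp only [shiftPoly_apply, map_add, inner_add_left, inner_add_right, inner_oscPoly_symm]

theorem re_inner_shiftPoly_self (hτ : 0 < τ) (p : Poly) :
    ‖hermite hτ p‖ ^ 2 + ∑ j, ‖hermite hτ (gaussDeriv τ j p)‖ ^ 2 ≤
      (inner ℂ (hermite hτ p) (hermite hτ (shiftPoly τ p))).re := by
  rw [shiftPoly_apply, map_add, inner_add_right, Complex.add_re, re_inner_oscPoly_self, re_inner_self_eq]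
  have : 0 ≤ τ ^ 2 * ∑ j, ‖hermite hτ (MvPolynomial.X j * p)‖ ^ 2 :=
    mul_nonneg (sq_nonneg _) (Finset.sum_nonneg fun _ _ => sq_nonneg _)
  linarith

theorem norm_le_norm_shiftPoly (hτ : 0 < τ) (p : Poly) :
    ‖hermite hτ p‖ ≤ ‖hermite hτ (shiftPoly τ p)‖ := by
  have h := re_inner_shiftPoly_self hτ p
  have h1 := (Complex.re_le_norm _).trans
    (norm_inner_le_norm (𝕜 := ℂ) (hermite hτ p) (hermite hτ (shiftPoly τ p)))
  have h2 : 0 ≤ ∑ j, ‖hermite hτ (gaussDeriv τ j p)‖ ^ 2 :=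
    Finset.sum_nonneg fun _ _ => sq_nonneg _
  by_contra! hlt
  nlinarith [norm_nonneg (hermite hτ p), norm_nonneg (hermite hτ (shiftPoly τ p))]

theorem norm_oscPoly_le (hτ : 0 < τ) (p : Poly) :
    ‖hermite hτ (oscPoly τ p)‖ ≤ ‖hermite hτ (shiftPoly τ p)‖ := by
  have h1 := norm_add_sq_eq (hermite hτ (oscPoly τ p)) (hermite hτ p)
  rw [← map_add, ← shiftPoly_apply, inner_oscPoly_symm, re_inner_oscPoly_self] at h1
  have h2 : 0 ≤ ∑ j, ‖hermite hτ (gaussDeriv τ j p)‖ ^ 2 :=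
    Finset.sum_nonneg fun _ _ => sq_nonneg _
  have h3 : 0 ≤ τ ^ 2 * ∑ j, ‖hermite hτ (MvPolynomial.X j * p)‖ ^ 2 :=
    mul_nonneg (sq_nonneg _) (Finset.sum_nonneg fun _ _ => sq_nonneg _)
  refine le_of_sq_le_sq ?_ (norm_nonneg _)
  nlinarith [sq_nonneg ‖hermite hτ p‖]

theorem exists_norm_lapPoly_le (hτ : 0 < τ) : ∃ C, ∀ p,
    ‖hermite hτ (lapPoly τ p)‖ ≤ C * ‖hermite hτ (shiftPoly τ p)‖ ∧
      ‖hermite hτ (normSqPoly * p)‖ ≤ C * ‖hermite hτ (shiftPoly τ p)‖ := by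
  -- The factor 1 + 2τ comes from 1 + 4τ² ≤ (1 + 2τ)²; the second factor allows for the division by
  -- τ² in the bound for |x|²p.
  set C : ℝ := (1 + 2 * τ) * (1 + (τ ^ 2)⁻¹)
  have key : ∀ p, (τ ^ 2 * ‖hermite hτ (normSqPoly * p)‖ ≤ (1 + 2 * τ) * ‖hermite hτ (shiftPoly τ p)‖)
      ∧ ‖hermite hτ (lapPoly τ p)‖ ≤ (1 + 2 * τ) * ‖hermite hτ (shiftPoly τ p)‖ := by
    intro p
    have h := norm_sq_oscPoly_ge hτ p
    have h1 := pow_le_pow_left₀ (norm_nonneg _) (norm_oscPoly_le hτ p) 2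
    have h2 := pow_le_pow_left₀ (norm_nonneg _) (norm_le_norm_shiftPoly hτ p) 2
    have h4 : ‖hermite hτ (lapPoly τ p)‖ ^ 2 + (τ ^ 2 * ‖hermite hτ (normSqPoly * p)‖) ^ 2 ≤
        ((1 + 2 * τ) * ‖hermite hτ (shiftPoly τ p)‖) ^ 2 := by
      nlinarith [sq_nonneg τ, mul_nonneg hτ.le (sq_nonneg ‖hermite hτ (shiftPoly τ p)‖)]
    constructor
    · refine le_of_sq_le_sq ?_ (by positivity)
      nlinarith [sq_nonneg ‖hermite hτ (lapPoly τ p)‖]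
    · refine le_of_sq_le_sq ?_ (by positivity)
      nlinarith [sq_nonneg (τ ^ 2 * ‖hermite hτ (normSqPoly * p)‖)]
  refine ⟨C, fun p => ⟨(key p).2.trans ?_, ?_⟩⟩
  · have : 0 ≤ (τ ^ 2)⁻¹ := by positivity
    gcongr
    exact le_mul_of_one_le_right (by positivity) (by linarith)
  · have h1 := (key p).1
    rw [← le_inv_mul_iff₀ (by positivity)] at h1
    refine h1.trans ?_
    rw [← mul_assoc]
    gcongr
    simp only [C]
    nlinarith [inv_pos.mpr (pow_pos hτ 2)]

/-- The imaginary part of `⟨S p, w p⟩` only involves first derivatives of `w`. -/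
theorem abs_im_inner_shiftPoly_mul_le (hτ : 0 < τ) {w : Poly} (hw : IsRealPoly w) (p : Poly) :
    |(inner ℂ (hermite hτ (shiftPoly τ p)) (hermite hτ (w * p))).im| ≤
      ∑ j, ‖hermite hτ (gaussDeriv τ j p)‖ * ‖hermite hτ (MvPolynomial.pderiv j w * p)‖ := by
  have h1 : normSqPoly * (w * p) = (normSqPoly * w) * p := by ring
  have h2 : IsRealPoly (normSqPoly * w) := by
    rw [IsRealPoly, map_mul, hw.eq, isRealPoly_normSqPoly.eq]
  have h3 : ((τ : ℂ) ^ 2 * inner ℂ (hermite hτ p) (hermite hτ (normSqPoly * (w * p)))).im = 0 := by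
    rw [← Complex.ofReal_pow, Complex.im_ofReal_mul, h1, inner_self_mul_real_im hτ h2, mul_zero]
  -- Of ∂_j(wp), the part w ∂_j p pairs with ∂_j p to a real number; only (∂_j w)p survives.
  have h4 : (inner ℂ (hermite hτ (shiftPoly τ p)) (hermite hτ (w * p))).im =
      ∑ j, (inner ℂ (hermite hτ (gaussDeriv τ j p))
        (hermite hτ (MvPolynomial.pderiv j w * p))).im := by
    rw [shiftPoly_apply, map_add, inner_add_left, Complex.add_im, inner_self_mul_real_im hτ hw,
      inner_oscPoly_left, Complex.add_im, h3, add_zero, add_zero, Complex.im_sum]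
    refine Finset.sum_congr rfl fun j _ => ?_
    rw [gaussDeriv_mul, map_add, inner_add_right, Complex.add_im, inner_self_mul_real_im hτ hw,
      add_zero]
  rw [h4]
  refine (Finset.abs_sum_le_sum_abs _ _).trans (Finset.sum_le_sum fun j _ => ?_)
  exact (Complex.abs_im_le_norm _).trans (norm_inner_le_norm _ _)

end

/-! ### Triangularity in the degree and compactness -/

section

section Flag

variable {P H : Type*} [AddCommGroup P] [Module ℂ P] [NormedAddCommGroup H] [InnerProductSpace ℂ H]
  {e : P →ₗ[ℂ] H} {A : P →ₗ[ℂ] P} {F : ℕ → Submodule ℂ P} {μ : ℕ → ℝ}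

theorem map_mem_flag (hF : Monotone F) (hstep : ∀ N, ∀ p ∈ F (N + 1), A p - (μ N : ℂ) • p ∈ F N)
    (h0 : F 0 = ⊥) {N : ℕ} {p : P} (hp : p ∈ F N) : A p ∈ F N := by
  cases N with
  | zero => simp_all
  | succ N =>
    have := (F (N + 1)).add_mem (hF N.le_succ (hstep N p hp)) ((F (N + 1)).smul_mem (μ N : ℂ) hp)
    simpa using this

/-- Back substitution: A is triangular along the flag with nonzero diagonal. -/
theorem exists_map_eq_of_mem_flag (hF : Monotone F)
    (hstep : ∀ N, ∀ p ∈ F (N + 1), A p - (μ N : ℂ) • p ∈ F N)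
    (h0 : F 0 = ⊥) (hμ : ∀ N, 0 < μ N) {N : ℕ} {p : P} (hp : p ∈ F N) :
    ∃ q ∈ F N, A q = p := by
  induction N generalizing p with
  | zero => exact ⟨0, zero_mem _, by simp_all⟩
  | succ N ih =>
    obtain ⟨q, hq, hAq⟩ := ih (hstep N p hp)
    have hne : (μ N : ℂ) ≠ 0 := by exact_mod_cast (hμ N).ne'
    refine ⟨(μ N : ℂ)⁻¹ • (p - q), (F (N + 1)).smul_mem _ ((F (N + 1)).sub_mem hp
      (hF N.le_succ hq)), ?_⟩
    rw [map_smul, map_sub, hAq, sub_sub_cancel, smul_smul, inv_mul_cancel₀ hne, one_smul]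

/-- A symmetric operator acting on each graded piece of a flag by a scalar is bounded below by these
scalars on the orthogonal complements of the members of the flag. -/
theorem flag_norm_le (hF : Monotone F)
    (hstep : ∀ N, ∀ p ∈ F (N + 1), A p - (μ N : ℂ) • p ∈ F N)
    (h0 : F 0 = ⊥) (hμ : ∀ N, 0 < μ N) (hμm : Monotone μ)
    (hsymm : ∀ p q, inner ℂ (e (A p)) (e q) = inner ℂ (e p) (e (A q)))
    (hfin : ∀ N, FiniteDimensional ℂ ((F N).map e)) {N M : ℕ} (hNM : N ≤ M) {p : P} (hp : p ∈ F M)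
    (hort : ∀ q ∈ F N, inner ℂ (e q) (e p) = 0) : μ N * ‖e p‖ ≤ ‖e (A p)‖ := by
  induction M, hNM using Nat.le_induction generalizing p with
  | base =>
    have := hort p hp
    rw [inner_self_eq_zero] at this
    simp [this]
  | succ M hNM ih =>
    have hproj := ((F M).map e).starProjection_apply_mem (e p)
    obtain ⟨q, hq, hqe⟩ := hproj
    have hr : p - q ∈ F (M + 1) := (F (M + 1)).sub_mem hp (hF M.le_succ hq)
    have hrort : ∀ s ∈ F M, inner ℂ (e s) (e (p - q)) = 0 := fun s hs => by
      rw [map_sub, hqe]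
      exact ((F M).map e).sub_starProjection_mem_orthogonal (e p) _ ⟨s, hs, rfl⟩
    -- The component orthogonal to the previous member is an eigenvector: its defect lies in that
    -- member by triangularity, and is orthogonal to it by symmetry.
    have hAr : e (A (p - q)) = (μ M : ℂ) • e (p - q) := by
      have hz : ∀ z ∈ F M, inner ℂ (e z) (e (A (p - q)) - (μ M : ℂ) • e (p - q)) = 0 := fun z hz => by
        rw [inner_sub_right, ← hsymm, hrort _ (map_mem_flag hF hstep h0 hz),
          inner_smul_right, hrort _ hz, mul_zero, sub_zero]
      have h1 := hz _ (hstep M _ hr)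
      rw [map_sub e, map_smul e, inner_self_eq_zero, sub_eq_zero] at h1
      exact h1
    have hqort : ∀ s ∈ F N, inner ℂ (e s) (e q) = 0 := fun s hs => by
      have h1 := hrort s (hF hNM hs)
      rw [map_sub, inner_sub_right, hort s hs, zero_sub, neg_eq_zero] at h1
      exact h1
    have hq' := ih hq hqort
    have hp' : p = q + (p - q) := by abel
    have h1 : ‖e p‖ ^ 2 = ‖e q‖ ^ 2 + ‖e (p - q)‖ ^ 2 := by
      conv_lhs => rw [hp', map_add]
      rw [norm_add_sq_eq, hrort q hq]
      simp
    have h2 : ‖e (A p)‖ ^ 2 = ‖e (A q)‖ ^ 2 + μ M ^ 2 * ‖e (p - q)‖ ^ 2 := by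
      conv_lhs => rw [hp', map_add, map_add]
      rw [norm_add_sq_eq, hAr, inner_smul_right, hrort _ (map_mem_flag hF hstep h0 hq), norm_smul,
        Complex.norm_real, Real.norm_of_nonneg (hμ M).le]
      simp only [mul_zero, Complex.zero_re]
      ring
    have h3 : μ N ^ 2 ≤ μ M ^ 2 := pow_le_pow_left₀ (hμ N).le (hμm hNM) 2
    have h4 := pow_le_pow_left₀ (mul_nonneg (hμ N).le (norm_nonneg _)) hq' 2
    refine le_of_sq_le_sq ?_ (norm_nonneg _)
    rw [mul_pow] at h4 ⊢
    rw [h1, h2]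
    nlinarith [mul_le_mul_of_nonneg_right h3 (sq_nonneg ‖e (p - q)‖)]

/-- K inverts A, so it has norm at most 1/μ_N off the finite-dimensional image of F_N. Hence K is
the norm limit of the finite rank operators KQ_N, with Q_N the orthogonal projections. -/
theorem isCompactOperator_of_flag [CompleteSpace H] (he : DenseRange e) (hF : Monotone F)
    (hstep : ∀ N, ∀ p ∈ F (N + 1), A p - (μ N : ℂ) • p ∈ F N)
    (h0 : F 0 = ⊥) (htop : ∀ p, ∃ N, p ∈ F N) (hμ : ∀ N, 0 < μ N) (hμm : Monotone μ)
    (hμt : Filter.Tendsto μ Filter.atTop Filter.atTop)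
    (hsymm : ∀ p q, inner ℂ (e (A p)) (e q) = inner ℂ (e p) (e (A q)))
    (hfin : ∀ N, FiniteDimensional ℂ ((F N).map e)) (K : H →L[ℂ] H) (hK : ∀ p, K (e (A p)) = e p) :
    IsCompactOperator K := by
  let Q : ℕ → H →L[ℂ] H := fun N => ((F N).map e).starProjection
  have hbound : ∀ N y, ‖K (y - Q N y)‖ ≤ (μ N)⁻¹ * ‖y‖ := fun N y => by
    refine he.induction_on (p := fun y => ‖K (y - Q N y)‖ ≤ (μ N)⁻¹ * ‖y‖) y ?_ fun p => ?_
    · exact isClosed_le (by fun_prop) (by fun_prop)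
    · obtain ⟨q, hq, hqe⟩ := ((F N).map e).starProjection_apply_mem (e p)
      have hort : ∀ s ∈ F N, inner ℂ (e s) (e (p - q)) = 0 := fun s hs => by
        rw [map_sub, hqe]
        exact ((F N).map e).sub_starProjection_mem_orthogonal (e p) _ ⟨s, hs, rfl⟩
      have hQ : e p - Q N (e p) = e (p - q) := by rw [map_sub, hqe]
      obtain ⟨M, hM⟩ := htop (p - q)
      obtain ⟨r, hr, hAr⟩ := exists_map_eq_of_mem_flag hF hstep h0 hμ hM
      -- Orthogonality to F_N passes from A r to r because A is symmetric and maps F_N onto itself.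
      have hrort : ∀ s ∈ F N, inner ℂ (e s) (e r) = 0 := fun s hs => by
        obtain ⟨s', hs', rfl⟩ := exists_map_eq_of_mem_flag hF hstep h0 hμ hs
        rw [hsymm, hAr, hort s' hs']
      have h1 := flag_norm_le hF hstep h0 hμ hμm hsymm hfin (le_max_left N M)
        (hF (le_max_right N M) hr) hrort
      rw [hAr] at h1
      have h2 : ‖e (p - q)‖ ≤ ‖e p‖ := by
        have h3 : ‖e p‖ ^ 2 = ‖e q‖ ^ 2 + ‖e (p - q)‖ ^ 2 := by
          conv_lhs => rw [show p = q + (p - q) by abel, map_add]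
          rw [norm_add_sq_eq, hort q hq]
          simp
        exact le_of_sq_le_sq (by nlinarith [sq_nonneg ‖e q‖]) (norm_nonneg _)
      rw [hQ, ← hAr, hK]
      rw [le_inv_mul_iff₀ (hμ N)]
      exact h1.trans h2
  have htend : Filter.Tendsto (fun N => K ∘L Q N) Filter.atTop (nhds K) := by
    rw [tendsto_iff_norm_sub_tendsto_zero]
    refine squeeze_zero (fun _ => norm_nonneg _) (fun N => ?_) hμt.inv_tendsto_atTop
    refine ContinuousLinearMap.opNorm_le_bound _ (inv_nonneg.mpr (hμ N).le) fun y => ?_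
    rw [← norm_neg]
    simpa [neg_sub] using! hbound N y
  refine isCompactOperator_of_tendsto htend (.of_forall fun N => ?_)
  have h1 : IsCompactOperator ((F N).map e).orthogonalProjectionOnto :=
    have := FiniteDimensional.proper ℂ ((F N).map e)
    isCompactOperator_of_locallyCompactSpace_dom ((F N).map e).orthogonalProjectionOnto
  exact (h1.clm_comp ((F N).map e).subtypeL).clm_comp K

end Flag

/-- The polynomials of degree less than `N`. -/
def polyFlag (N : ℕ) : Submodule ℂ Poly :=
  Submodule.span ℂ ((fun s => MvPolynomial.monomial s (1 : ℂ)) '' {s | s.degree < N})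

theorem monomial_mem_polyFlag {N : ℕ} {s : Fin 2 →₀ ℕ} (hs : s.degree < N) (c : ℂ) :
    MvPolynomial.monomial s c ∈ polyFlag N := by
  have : MvPolynomial.monomial s c = c • MvPolynomial.monomial s (1 : ℂ) := by
    simp [MvPolynomial.smul_monomial]
  rw [this]
  exact Submodule.smul_mem _ _ (Submodule.subset_span ⟨s, hs, rfl⟩)

theorem polyFlag_zero : polyFlag 0 = ⊥ := by simp [polyFlag]

theorem polyFlag_mono : Monotone polyFlag := fun _ _ h =>
  Submodule.span_mono (Set.image_mono fun _ hs => lt_of_lt_of_le hs h)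

theorem exists_mem_polyFlag (p : Poly) : ∃ N, p ∈ polyFlag N := by
  induction p using MvPolynomial.monomial_add_induction_on with
  | C a => exact ⟨1, monomial_mem_polyFlag (s := 0) (by simp) a⟩
  | monomial_add s a p _ _ hp =>
    obtain ⟨N, hN⟩ := hp
    exact ⟨max N (s.degree + 1), Submodule.add_mem _ (monomial_mem_polyFlag (by simp) a)
      (polyFlag_mono (le_max_left _ _) hN)⟩

instance finiteDimensional_polyFlag (N : ℕ) : FiniteDimensional ℂ (polyFlag N) := by
  refine FiniteDimensional.span_of_finite ℂ (Set.Finite.image _ ?_)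
  exact (Finsupp.finite_of_degree_le N).subset fun s (hs : s.degree < N) => Set.mem_ofPred.mpr hs.le

theorem pderiv_pderiv_monomial_mem {N : ℕ} {s : Fin 2 →₀ ℕ} (hs : s.degree ≤ N) (j : Fin 2)
    (c : ℂ) : MvPolynomial.pderiv j (MvPolynomial.pderiv j (MvPolynomial.monomial s c)) ∈
      polyFlag N := by
  rw [MvPolynomial.pderiv_monomial, MvPolynomial.pderiv_monomial]
  by_cases h : s j = 0
  · simp [h]
  · refine monomial_mem_polyFlag ?_ _
    have h1 : (s - Finsupp.single j 1) + Finsupp.single j 1 = s :=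
      tsub_add_cancel_of_le (by simpa [Finsupp.single_le_iff] using Nat.one_le_iff_ne_zero.mpr h)
    have h2 := congrArg Finsupp.degree h1
    rw [map_add, Finsupp.degree_single] at h2
    have h3 := Finsupp.degree_mono (tsub_le_self :
      s - Finsupp.single j 1 - Finsupp.single j 1 ≤ s - Finsupp.single j 1)
    omega

/-- Conjugating by the Gaussian cancels τ²|x|² and leaves the Euler operator, which is diagonal on
monomials, minus the Laplacian, which lowers the degree. -/
theorem shiftPoly_eq (τ : ℝ) (p : Poly) :
    shiftPoly τ p = (2 * τ + 1 : ℂ) • p +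
      (2 * τ : ℂ) • (MvPolynomial.X 0 * MvPolynomial.pderiv 0 p +
        MvPolynomial.X 1 * MvPolynomial.pderiv 1 p) -
      (MvPolynomial.pderiv 0 (MvPolynomial.pderiv 0 p) +
        MvPolynomial.pderiv 1 (MvPolynomial.pderiv 1 p)) := by
  simp only [shiftPoly_apply, oscPoly_apply, lapPoly_apply, gaussDeriv_apply, normSqPoly,
    map_sub, Derivation.leibniz, smul_eq_mul, MvPolynomial.smul_eq_C_mul, map_add, map_mul, map_pow,
    MvPolynomial.pderiv_C, MvPolynomial.pderiv_X_self, map_one, map_ofNat]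
  ring

theorem shiftPoly_sub_smul_mem_polyFlag (τ : ℝ) (N : ℕ) {p : Poly} (hp : p ∈ polyFlag (N + 1)) :
    shiftPoly τ p - ((2 * τ * (N + 1) + 1 : ℝ) : ℂ) • p ∈ polyFlag N := by
  have : polyFlag (N + 1) ≤ (polyFlag N).comap
      (shiftPoly τ - ((2 * τ * (N + 1) + 1 : ℝ) : ℂ) • LinearMap.id) := by
    refine Submodule.span_le.mpr ?_
    rintro _ ⟨s, hs, rfl⟩
    have hs' : s.degree ≤ N := Nat.lt_succ_iff.mp hs
    have hdeg : s.degree = s 0 + s 1 := by simp [Finsupp.degree_eq_sum]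
    have h1 : shiftPoly τ (MvPolynomial.monomial s (1 : ℂ)) -
        ((2 * τ * (N + 1) + 1 : ℝ) : ℂ) • MvPolynomial.monomial s (1 : ℂ) =
        (2 * τ * (s.degree - N) : ℂ) • MvPolynomial.monomial s (1 : ℂ) -
        (MvPolynomial.pderiv 0 (MvPolynomial.pderiv 0 (MvPolynomial.monomial s (1 : ℂ))) +
          MvPolynomial.pderiv 1 (MvPolynomial.pderiv 1 (MvPolynomial.monomial s (1 : ℂ)))) := by
      rw [shiftPoly_eq, MvPolynomial.X_mul_pderiv_monomial, MvPolynomial.X_mul_pderiv_monomial, hdeg]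
      rw [← Nat.cast_smul_eq_nsmul ℂ, ← Nat.cast_smul_eq_nsmul ℂ]
      push_cast
      module
    change shiftPoly τ (MvPolynomial.monomial s 1) -
      ((2 * τ * (N + 1) + 1 : ℝ) : ℂ) • MvPolynomial.monomial s (1 : ℂ) ∈ polyFlag N
    rw [h1]
    refine Submodule.sub_mem _ ?_ (Submodule.add_mem _ (pderiv_pderiv_monomial_mem hs' 0 1)
      (pderiv_pderiv_monomial_mem hs' 1 1))
    -- The members of `polyFlag (N + 1)` have degree at most N; in degree exactly N the diagonal
    -- entry 2τN + 2τ + 1 is the subtracted scalar.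
    rcases hs'.lt_or_eq with h | h
    · exact Submodule.smul_mem _ _ (monomial_mem_polyFlag h 1)
    · simp [h]
  exact this hp

variable {τ : ℝ}

theorem shiftPoly_surjective (hτ : 0 < τ) : Function.Surjective (shiftPoly τ) := fun p => by
  obtain ⟨N, hN⟩ := exists_mem_polyFlag p
  obtain ⟨q, -, hq⟩ := exists_map_eq_of_mem_flag polyFlag_mono
    (fun N p hp => shiftPoly_sub_smul_mem_polyFlag τ N hp) polyFlag_zero
    (fun N => by positivity) hN
  exact ⟨q, hq⟩

theorem isCompactOperator_of_hermite_shiftPoly (hτ : 0 < τ) (K : L2 →L[ℂ] L2)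
    (hK : ∀ p, K (hermite hτ (shiftPoly τ p)) = hermite hτ p) : IsCompactOperator K := by
  refine isCompactOperator_of_flag (denseRange_hermite hτ) polyFlag_mono
    (fun N p hp => shiftPoly_sub_smul_mem_polyFlag τ N hp) polyFlag_zero exists_mem_polyFlag
    (fun N => by positivity) ?_ ?_ (inner_shiftPoly_symm hτ) (fun N => inferInstance) K hK
  · intro N M h
    have : (N : ℝ) ≤ M := by exact_mod_cast h
    simp only
    gcongr
  · refine Filter.tendsto_atTop_add_const_right _ _ (Filter.Tendsto.const_mul_atTop (by positivity)
      (Filter.tendsto_atTop_add_const_right _ _ tendsto_natCast_atTop_atTop))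

end

/-! ### The oscillator and its resolvent in L² -/

section

variable {τ : ℝ}

theorem mem_mulOp_graph_iff {v : Plane → ℝ} {u f : L2} :
    (u, f) ∈ (mulOp v).graph ↔ (fun x => (v x : ℂ) * u x) =ᵐ[volume] f := by
  rw [LinearPMap.mem_graph_iff]
  constructor
  · rintro ⟨y, hy, hf⟩
    obtain rfl : (y : L2) = u := hy
    obtain rfl : mulOp v y = f := hf
    exact (memLp_of_mem_mulDomain y.2).coeFn_toLp.symm
  · intro h
    have hu : u ∈ mulDomain v := (Lp.memLp f).ae_eq h.symm
    refine ⟨⟨u, hu⟩, rfl, Lp.ext ?_⟩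
    exact (memLp_of_mem_mulDomain hu).coeFn_toLp.trans h

theorem mem_laplacianGraph_iff {u d : L2} :
    (u, d) ∈ laplacianGraph ↔ Δ (u : 𝓢'(Plane, ℂ)) = (d : 𝓢'(Plane, ℂ)) := Iff.rfl

theorem laplacian_integral_eq {u d : L2} (h : (u, d) ∈ laplacianGraph) (φ : 𝓢(Plane, ℂ)) :
    ∫ x, (Δ φ) x * u x = ∫ x, φ x * d x := by
  have := congrArg (fun T : 𝓢'(Plane, ℂ) => T φ) (mem_laplacianGraph_iff.mp h)
  simpa using this

theorem toLp_mem_laplacianGraph (φ : 𝓢(Plane, ℂ)) :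
    ((φ.toLp 2 volume, (Δ φ).toLp 2 volume) : L2 × L2) ∈ laplacianGraph := by
  rw [mem_laplacianGraph_iff, Lp.toTemperedDistribution_toLp_eq, Lp.toTemperedDistribution_toLp_eq,
    TemperedDistribution.laplacian_toTemperedDistributionCLM_eq]

theorem isClosed_laplacianGraph : IsClosed (laplacianGraph : Set (L2 × L2)) := by
  have h1 : Continuous fun p : L2 × L2 => Δ (p.1 : 𝓢'(Plane, ℂ)) := by
    simp only [← Lp.toTemperedDistributionCLM_apply, ← TemperedDistribution.laplacianCLM_apply]
    exact (ContinuousLinearMap.continuous _).comp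
      ((ContinuousLinearMap.continuous _).comp continuous_fst)
  have h2 : Continuous fun p : L2 × L2 => (p.2 : 𝓢'(Plane, ℂ)) := by
    simp only [← Lp.toTemperedDistributionCLM_apply]
    exact (ContinuousLinearMap.continuous _).comp continuous_snd
  exact isClosed_eq h1 h2

theorem map_conj_lapPoly (τ : ℝ) (p : Poly) :
    MvPolynomial.map (starRingEnd ℂ) (lapPoly τ p) =
      lapPoly τ (MvPolynomial.map (starRingEnd ℂ) p) := by
  simp [lapPoly_apply, map_conj_gaussDeriv]

theorem laplacian_polyGauss_eq (hτ : 0 < τ) (p : Poly) :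
    Δ (polyGauss hτ p) = polyGauss hτ (lapPoly τ p) := by
  rw [laplacian_polyGauss, Fin.sum_univ_two, lapPoly_apply]

theorem hermite_mem_laplacianGraph (hτ : 0 < τ) (p : Poly) :
    (hermite hτ p, hermite hτ (lapPoly τ p)) ∈ laplacianGraph := by
  have := toLp_mem_laplacianGraph (polyGauss hτ p)
  rwa [laplacian_polyGauss_eq] at this

theorem inner_lapPoly_eq (hτ : 0 < τ) {u d : L2} (h : (u, d) ∈ laplacianGraph) (p : Poly) :
    inner ℂ (hermite hτ (lapPoly τ p)) u = inner ℂ (hermite hτ p) d := by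
  rw [inner_hermite, inner_hermite, map_conj_lapPoly, ← laplacian_polyGauss_eq,
    laplacian_integral_eq h]

theorem inner_hermite_mul_eq (hτ : 0 < τ) {w : Poly} (hw : IsRealPoly w) {u f : L2}
    (h : (fun x => polyEval w x * u x) =ᵐ[volume] f) (p : Poly) :
    inner ℂ (hermite hτ (w * p)) u = inner ℂ (hermite hτ p) f := by
  rw [inner_hermite, inner_hermite, map_mul, hw.eq]
  refine integral_congr_ae ?_
  filter_upwards [h] with x hx
  rw [← hx, polyGauss_apply, polyGauss_apply, polyEval_mul]
  ring

/-- The linear map `p ↦ (1 + S) p` into `L²`, where `S = -Δ + τ² |x|²`. -/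
def hermiteShift (hτ : 0 < τ) : Poly →ₗ[ℂ] L2 := hermite hτ ∘ₗ shiftPoly τ

theorem hermiteShift_apply (hτ : 0 < τ) (p : Poly) :
    hermiteShift hτ p = hermite hτ (shiftPoly τ p) := rfl

theorem denseRange_hermiteShift (hτ : 0 < τ) : DenseRange (hermiteShift hτ) := by
  have : Set.range (hermiteShift hτ) = Set.range (hermite hτ) :=
    (shiftPoly_surjective hτ).range_comp (hermite hτ)
  rw [DenseRange, this]
  exact denseRange_hermite hτ

/-- The resolvent `(1 + S)⁻¹` of the harmonic oscillator `S = -Δ + τ² |x|²`. -/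
def oscResolvent (hτ : 0 < τ) : L2 →L[ℂ] L2 := (hermite hτ).extendOfNorm (hermiteShift hτ)

theorem oscResolvent_hermiteShift (hτ : 0 < τ) (p : Poly) :
    oscResolvent hτ (hermiteShift hτ p) = hermite hτ p :=
  LinearMap.extendOfNorm_eq (denseRange_hermiteShift hτ)
    ⟨1, fun p => by rw [one_mul]; exact norm_le_norm_shiftPoly hτ p⟩ p

theorem isCompactOperator_oscResolvent (hτ : 0 < τ) : IsCompactOperator (oscResolvent hτ) :=
  isCompactOperator_of_hermite_shiftPoly hτ _ (oscResolvent_hermiteShift hτ)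

/-- The bounded operator `Δ (1 + S)⁻¹`. -/
def lapResolvent (hτ : 0 < τ) : L2 →L[ℂ] L2 :=
  (hermite hτ ∘ₗ lapPoly τ).extendOfNorm (hermiteShift hτ)

theorem lapResolvent_hermiteShift (hτ : 0 < τ) (p : Poly) :
    lapResolvent hτ (hermiteShift hτ p) = hermite hτ (lapPoly τ p) := by
  obtain ⟨C, hC⟩ := exists_norm_lapPoly_le hτ
  exact LinearMap.extendOfNorm_eq (denseRange_hermiteShift hτ) ⟨C, fun p => (hC p).1⟩ p

/-- The bounded operator `|x|² (1 + S)⁻¹`. -/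
def normSqResolvent (hτ : 0 < τ) : L2 →L[ℂ] L2 :=
  (hermite hτ ∘ₗ LinearMap.mulLeft ℂ normSqPoly).extendOfNorm (hermiteShift hτ)

theorem normSqResolvent_hermiteShift (hτ : 0 < τ) (p : Poly) :
    normSqResolvent hτ (hermiteShift hτ p) = hermite hτ (normSqPoly * p) := by
  obtain ⟨C, hC⟩ := exists_norm_lapPoly_le hτ
  exact LinearMap.extendOfNorm_eq (denseRange_hermiteShift hτ) ⟨C, fun p => (hC p).2⟩ p

theorem oscResolvent_mem_laplacianGraph (hτ : 0 < τ) (y : L2) :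
    (oscResolvent hτ y, lapResolvent hτ y) ∈ laplacianGraph := by
  refine (denseRange_hermiteShift hτ).induction_on
    (p := fun y => (oscResolvent hτ y, lapResolvent hτ y) ∈ laplacianGraph) y ?_ fun p => ?_
  · exact isClosed_laplacianGraph.preimage (by fun_prop)
  · rw [oscResolvent_hermiteShift, lapResolvent_hermiteShift]
    exact hermite_mem_laplacianGraph hτ p

/-- The identity holds weakly on a dense set of y and both sides are continuous in y; moment
determinacy then makes it pointwise, which places the range in the maximal domain of |x|². -/
theorem normSq_mul_oscResolvent (hτ : 0 < τ) (y : L2) :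
    (fun x => polyEval normSqPoly x * oscResolvent hτ y x) =ᵐ[volume] normSqResolvent hτ y := by
  refine polyEval_mul_ae_eq_of_inner_eq hτ normSqPoly isRealPoly_normSqPoly _ _ fun p => ?_
  refine (denseRange_hermiteShift hτ).induction_on (p := fun y =>
    inner ℂ (hermite hτ (normSqPoly * p)) (oscResolvent hτ y) =
      inner ℂ (hermite hτ p) (normSqResolvent hτ y)) y ?_ fun q => ?_
  · exact isClosed_eq (by fun_prop) (by fun_prop)
  · rw [oscResolvent_hermiteShift, normSqResolvent_hermiteShift,
      inner_hermite_mul_left hτ isRealPoly_normSqPoly]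

theorem oscResolvent_mem_mulOp_graph (hτ : 0 < τ) (y : L2) :
    (oscResolvent hτ y, normSqResolvent hτ y) ∈ (mulOp fun x => ‖x‖ ^ 2).graph := by
  rw [mem_mulOp_graph_iff]
  filter_upwards [normSq_mul_oscResolvent hτ y] with x hx
  rw [← hx, polyEval_normSqPoly]

theorem shift_oscResolvent (hτ : 0 < τ) (y : L2) :
    -lapResolvent hτ y + (τ ^ 2 : ℂ) • normSqResolvent hτ y + oscResolvent hτ y = y := by
  refine (denseRange_hermiteShift hτ).induction_on (p := fun y =>
    -lapResolvent hτ y + (τ ^ 2 : ℂ) • normSqResolvent hτ y + oscResolvent hτ y = y) y ?_ fun p => ?_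
  · exact isClosed_eq (by fun_prop) (by fun_prop)
  · rw [oscResolvent_hermiteShift, lapResolvent_hermiteShift, normSqResolvent_hermiteShift,
      hermiteShift_apply, shiftPoly_apply, oscPoly_apply]
    simp only [map_add, map_neg, map_smul]

theorem inner_hermiteShift_oscResolvent (hτ : 0 < τ) (p : Poly) (y : L2) :
    inner ℂ (hermiteShift hτ p) (oscResolvent hτ y) = inner ℂ (hermite hτ p) y := by
  refine (denseRange_hermiteShift hτ).induction_on (p := fun y =>
    inner ℂ (hermiteShift hτ p) (oscResolvent hτ y) = inner ℂ (hermite hτ p) y) y ?_ fun q => ?_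
  · exact isClosed_eq (by fun_prop) (by fun_prop)
  · rw [oscResolvent_hermiteShift, hermiteShift_apply, hermiteShift_apply, inner_shiftPoly_symm]

theorem inner_oscResolvent_right (hτ : 0 < τ) (z y : L2) :
    inner ℂ z (oscResolvent hτ y) = inner ℂ (oscResolvent hτ z) y := by
  refine (denseRange_hermiteShift hτ).induction_on (p := fun z =>
    inner ℂ z (oscResolvent hτ y) = inner ℂ (oscResolvent hτ z) y) z ?_ fun q => ?_
  · exact isClosed_eq (by fun_prop) (by fun_prop)
  · rw [oscResolvent_hermiteShift, inner_hermiteShift_oscResolvent]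

theorem norm_sq_oscResolvent_le (hτ : 0 < τ) (y : L2) :
    ‖oscResolvent hτ y‖ ^ 2 ≤ (inner ℂ (oscResolvent hτ y) y).re := by
  refine (denseRange_hermiteShift hτ).induction_on (p := fun y =>
    ‖oscResolvent hτ y‖ ^ 2 ≤ (inner ℂ (oscResolvent hτ y) y).re) y ?_ fun p => ?_
  · exact isClosed_le (by fun_prop) (Complex.continuous_re.comp (by fun_prop))
  · rw [oscResolvent_hermiteShift, hermiteShift_apply]
    refine le_trans ?_ (re_inner_shiftPoly_self hτ p)
    exact le_add_of_nonneg_right (Finset.sum_nonneg fun _ _ => sq_nonneg _)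

theorem im_inner_oscResolvent (hτ : 0 < τ) (y : L2) :
    (inner ℂ (oscResolvent hτ y) y).im = 0 := by
  rw [← Complex.conj_eq_iff_im, inner_conj_symm, inner_oscResolvent_right]

theorem oscResolvent_injective (hτ : 0 < τ) : Function.Injective (oscResolvent hτ) := by
  rw [injective_iff_map_eq_zero]
  intro y hy
  refine eq_of_inner_hermite_eq hτ y 0 fun p => ?_
  rw [← inner_hermiteShift_oscResolvent, hy, inner_zero_right, inner_zero_right]

/-- Every element of `D(Δ) ∩ D(|x|²)` is in the range of the resolvent. -/
theorem eq_oscResolvent (hτ : 0 < τ) {u d m : L2} (hd : (u, d) ∈ laplacianGraph)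
    (hm : (u, m) ∈ (mulOp fun x => ‖x‖ ^ 2).graph) :
    u = oscResolvent hτ (-d + (τ ^ 2 : ℂ) • m + u) := by
  rw [mem_mulOp_graph_iff] at hm
  have hm' : (fun x => polyEval normSqPoly x * u x) =ᵐ[volume] m := by
    filter_upwards [hm] with x hx
    rw [← hx, polyEval_normSqPoly]
  refine eq_of_inner_hermite_eq hτ _ _ fun p => ?_
  -- Test functions of the form (1 + S)q suffice, and on them S can be moved onto u by the
  -- distributional definition of Δu.
  obtain ⟨q, rfl⟩ := shiftPoly_surjective hτ p
  rw [← hermiteShift_apply, inner_hermiteShift_oscResolvent, hermiteShift_apply, shiftPoly_apply,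
    oscPoly_apply]
  simp only [map_add, map_neg, map_smul, inner_add_left, inner_add_right, inner_neg_left,
    inner_neg_right, inner_smul_left, inner_smul_right]
  rw [inner_lapPoly_eq hτ hd, inner_hermite_mul_eq hτ isRealPoly_normSqPoly hm']
  simp

end

/-! ### Solving the equation with the cubic potential -/

section

/-- A linear map bounded below has weakly solvable adjoint equation. -/
theorem exists_inner_eq_of_norm_le {P H : Type*} [AddCommGroup P] [Module ℂ P]
    [NormedAddCommGroup H] [InnerProductSpace ℂ H] [CompleteSpace H] (J e : P →ₗ[ℂ] H) {C : ℝ}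
    (h : ∀ p, ‖e p‖ ≤ C * ‖J p‖) (f : H) : ∃ w, ∀ p, inner ℂ (J p) w = inner ℂ (e p) f := by
  -- The map J p ↦ e p is well defined and bounded, so it extends to M; the solution is its adjoint
  -- applied to f.
  let M := (LinearMap.range J).topologicalClosure
  let J' : P →ₗ[ℂ] M := J.codRestrict M fun p => subset_closure ⟨p, rfl⟩
  have hd : DenseRange J' := by
    intro x
    rw [closure_subtype, ← Set.range_comp]
    exact x.2
  have hT := LinearMap.extendOfNorm_eq (f := e) (e := J') hd ⟨C, h⟩
  set T : M →L[ℂ] H := e.extendOfNorm J'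
  refine ⟨(T.adjoint f : M), fun p => ?_⟩
  have : inner ℂ (J' p) (T.adjoint f) = inner ℂ (e p) f := by
    rw [ContinuousLinearMap.adjoint_inner_right, hT]
  exact this

variable {τ : ℝ}

/-- Existence for S + l + bw, in the unknown y = (1 + S)u. Pairing the adjoint expression with (1 +
S)p bounds it below by ‖(1 + S)p‖, because the w-term, divided by b, has an imaginary part involving
only first derivatives of p and w. -/
theorem exists_solution (hτ : 0 < τ) {w : Poly} (hw : IsRealPoly w) {C : ℝ}
    (hwC : ∀ j p, ‖hermite hτ (MvPolynomial.pderiv j w * p)‖ ≤ C * ‖hermite hτ (shiftPoly τ p)‖)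
    {b : ℂ} (hb : 0 < b.im) : ∃ l : ℝ, 1 ≤ l ∧ ∀ f : L2, ∃ y g : L2,
      (fun x => polyEval w x * oscResolvent hτ y x) =ᵐ[volume] g ∧
        y + ((l - 1 : ℝ) : ℂ) • oscResolvent hτ y + b • g = f := by
  have hb0 : b ≠ 0 := fun h => by simp [h] at hb
  set η : ℝ := -(b⁻¹).im with hη
  have hηpos : 0 < η := by
    rw [hη, Complex.inv_im, neg_div, neg_neg]
    exact div_pos hb (Complex.normSq_pos.mpr hb0)
  -- By the arithmetic-geometric inequality the commutator costs η‖y‖²/2 plus (C²/η)⟨p, (1 + S)p⟩;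
  -- this l makes the shift pay for the second term exactly.
  set l : ℝ := 1 + C ^ 2 / η ^ 2 with hl
  refine ⟨l, by rw [hl]; linarith [div_nonneg (sq_nonneg C) (sq_nonneg η)], fun f => ?_⟩
  -- The formal adjoint of y ↦ y + (l - 1)Ky + bwKy, with K = (1 + S)⁻¹, evaluated at (1 + S)p.
  let J : Poly →ₗ[ℂ] L2 := hermiteShift hτ + ((l - 1 : ℝ) : ℂ) • hermite hτ +
    (starRingEnd ℂ b) • ((oscResolvent hτ).toLinearMap ∘ₗ hermite hτ ∘ₗ
      LinearMap.mulLeft ℂ w ∘ₗ shiftPoly τ)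
  have hJ : ∀ p, J p = hermiteShift hτ p + ((l - 1 : ℝ) : ℂ) • hermite hτ p +
    (starRingEnd ℂ b) • oscResolvent hτ (hermite hτ (w * shiftPoly τ p)) := fun p => rfl
  have hinner : ∀ p (z : L2), inner ℂ (J p) z = inner ℂ (hermiteShift hτ p) z +
      ((l - 1 : ℝ) : ℂ) * inner ℂ (hermite hτ p) z +
      b * inner ℂ (hermite hτ (w * shiftPoly τ p)) (oscResolvent hτ z) := fun p z => by
    rw [hJ, inner_add_left, inner_add_left, inner_smul_left, inner_smul_left,
      ← inner_oscResolvent_right, Complex.conj_conj, Complex.conj_ofReal]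
  have hbound : ∀ p, ‖hermiteShift hτ p‖ ≤ (2 * ‖b⁻¹‖ / η) * ‖J p‖ := fun p => by
    set y := hermiteShift hτ p with hy
    have h1 := hinner p y
    rw [oscResolvent_hermiteShift, inner_hermite_mul_left hτ hw, ← hermiteShift_apply, ← hy] at h1
    set q : ℝ := (inner ℂ (hermite hτ p) y).re with hq
    have hqim : inner ℂ (hermite hτ p) y = (q : ℂ) := by
      refine Complex.ext rfl ?_
      rw [hy, ← oscResolvent_hermiteShift hτ p, im_inner_oscResolvent, Complex.ofReal_im]
    have hyy : inner ℂ y y = ((‖y‖ ^ 2 : ℝ) : ℂ) := by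
      rw [inner_self_eq_norm_sq_to_K]; norm_cast
    rw [hqim, hyy] at h1
    have h2 : (b⁻¹ * inner ℂ (J p) y).im =
        -η * (‖y‖ ^ 2 + (l - 1) * q) + (inner ℂ y (hermite hτ (w * p))).im := by
      rw [h1, mul_add, ← mul_assoc b⁻¹ b, inv_mul_cancel₀ hb0, one_mul, Complex.add_im, hη, neg_neg,
        ← Complex.ofReal_mul, ← Complex.ofReal_add, Complex.im_mul_ofReal]
    have h3 := abs_im_inner_shiftPoly_mul_le hτ hw p
    have h4 := re_inner_shiftPoly_self hτ p
    rw [← hermiteShift_apply, ← hy, Fin.sum_univ_two] at h3 h4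
    rw [← hq] at h4
    have h5 := hwC 0 p
    have h6 := hwC 1 p
    rw [← hermiteShift_apply, ← hy] at h5 h6
    set D0 := ‖hermite hτ (gaussDeriv τ 0 p)‖
    set D1 := ‖hermite hτ (gaussDeriv τ 1 p)‖
    have hD0 : 0 ≤ D0 := norm_nonneg _
    have hD1 : 0 ≤ D1 := norm_nonneg _
    have h7 : |(inner ℂ y (hermite hτ (w * p))).im| ≤ (D0 + D1) * (C * ‖y‖) := by
      refine h3.trans ?_
      nlinarith [mul_le_mul_of_nonneg_left h5 hD0, mul_le_mul_of_nonneg_left h6 hD1]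
    have h8 : ‖b⁻¹ * inner ℂ (J p) y‖ ≤ ‖b⁻¹‖ * (‖J p‖ * ‖y‖) := by
      rw [norm_mul]
      gcongr
      exact norm_inner_le_norm _ _
    have h9 := (Complex.abs_im_le_norm _).trans h8
    rw [h2] at h9
    have h10 : (D0 + D1) * (C * ‖y‖) ≤ η / 2 * ‖y‖ ^ 2 + η * ((l - 1) * q) := by
      have e1 : l - 1 = C ^ 2 / η ^ 2 := by rw [hl]; ring
      have e2 : (D0 + D1) ^ 2 ≤ 2 * q := by
        nlinarith [sq_nonneg (D0 - D1), sq_nonneg ‖hermite hτ p‖]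
      have e3 : η * ((l - 1) * q) = C ^ 2 / η * q := by rw [e1]; field_simp
      have e4 : 0 ≤ (η * ‖y‖ - C * (D0 + D1)) ^ 2 / (2 * η) := by positivity
      have e5 : (η * ‖y‖ - C * (D0 + D1)) ^ 2 / (2 * η) =
          η / 2 * ‖y‖ ^ 2 - (D0 + D1) * (C * ‖y‖) + C ^ 2 / η * ((D0 + D1) ^ 2 / 2) := by
        field_simp; ring
      have e6 : C ^ 2 / η * ((D0 + D1) ^ 2 / 2) ≤ C ^ 2 / η * q := by gcongr; linarith
      linarith
    have h11 : η / 2 * ‖y‖ ^ 2 ≤ ‖b⁻¹‖ * (‖J p‖ * ‖y‖) := by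
      have := (neg_abs_le (-η * (‖y‖ ^ 2 + (l - 1) * q) + (inner ℂ y (hermite hτ (w * p))).im))
      have := le_abs_self (inner ℂ y (hermite hτ (w * p))).im
      nlinarith
    rcases (norm_nonneg y).eq_or_lt with hy0 | hy0
    · rw [← hy0]; positivity
    · have h12 : η / 2 * ‖y‖ ≤ ‖b⁻¹‖ * ‖J p‖ := by
        refine le_of_mul_le_mul_right ?_ hy0
        linarith
      rw [div_mul_eq_mul_div, le_div_iff₀ hηpos]
      linarith
  obtain ⟨y, hy⟩ := exists_inner_eq_of_norm_le J (hermiteShift hτ) hbound f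
  -- The equation dictates g; the weak formulation and moment determinacy show that it really is w
  -- times Ky.
  refine ⟨y, b⁻¹ • (f - y - ((l - 1 : ℝ) : ℂ) • oscResolvent hτ y), ?_, ?_⟩
  · refine polyEval_mul_ae_eq_of_inner_eq hτ w hw _ _ fun p => ?_
    obtain ⟨p, rfl⟩ := shiftPoly_surjective hτ p
    have h1 := hy p
    rw [hinner, ← inner_hermiteShift_oscResolvent] at h1
    rw [← hermiteShift_apply, inner_smul_right, inner_sub_right, inner_sub_right, inner_smul_right,
      ← h1]
    field_simp
    ring
  · rw [smul_smul, mul_inv_cancel₀ hb0, one_smul]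
    abel

/-- The numerical range estimate. -/
theorem norm_oscResolvent_le_of_eq (hτ : 0 < τ) {v : Plane → ℝ} {b : ℂ} (hb : 0 < b.im) {l : ℝ}
    (hl : 1 ≤ l) {y g f : L2} (hg : (oscResolvent hτ y, g) ∈ (mulOp v).graph)
    (hf : y + ((l - 1 : ℝ) : ℂ) • oscResolvent hτ y + b • g = f) :
    ‖oscResolvent hτ y‖ ≤ (‖b⁻¹‖ / -(b⁻¹).im) * ‖f‖ := by
  have hb0 : b ≠ 0 := fun h => by simp [h] at hb
  set η : ℝ := -(b⁻¹).im with hη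
  have hηpos : 0 < η := by
    rw [hη, Complex.inv_im, neg_div, neg_neg]
    exact div_pos hb (Complex.normSq_pos.mpr hb0)
  set u := oscResolvent hτ y with hu
  have him : (inner ℂ u g).im = 0 := by
    rw [mem_mulOp_graph_iff] at hg
    rw [← Complex.conj_eq_iff_im, inner_conj_symm, L2.inner_def, L2.inner_def]
    refine integral_congr_ae ?_
    filter_upwards [hg] with x hx
    rw [← hx]
    simp
    ring
  have h1 : inner ℂ u f = inner ℂ u y + ((l - 1 : ℝ) : ℂ) * inner ℂ u u + b * inner ℂ u g := by
    rw [← hf, inner_add_right, inner_add_right, inner_smul_right, inner_smul_right]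
  have h2 := norm_sq_oscResolvent_le hτ y
  have h3 := im_inner_oscResolvent hτ y
  rw [← hu] at h2 h3
  have h4 : inner ℂ u y = (((inner ℂ u y).re : ℝ) : ℂ) := Complex.ext rfl h3
  have h5 : inner ℂ u u = ((‖u‖ ^ 2 : ℝ) : ℂ) := by
    rw [inner_self_eq_norm_sq_to_K]; norm_cast
  -- Division by b makes the potential term real, so it drops out of the imaginary part.
  have h6 : (b⁻¹ * inner ℂ u f).im = -η * ((inner ℂ u y).re + (l - 1) * ‖u‖ ^ 2) := by
    rw [h1, mul_add, ← mul_assoc b⁻¹ b, inv_mul_cancel₀ hb0, one_mul, Complex.add_im, him, h5, h4,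
      Complex.ofReal_re, ← Complex.ofReal_mul, ← Complex.ofReal_add, Complex.im_mul_ofReal, hη,
      neg_neg, add_zero]
  have h7 : ‖b⁻¹ * inner ℂ u f‖ ≤ ‖b⁻¹‖ * (‖u‖ * ‖f‖) := by
    rw [norm_mul]
    gcongr
    exact norm_inner_le_norm _ _
  have h8 := (neg_abs_le _).trans' (neg_le_neg ((Complex.abs_im_le_norm _).trans h7))
  rw [h6] at h8
  have h9 : η * ‖u‖ ^ 2 ≤ ‖b⁻¹‖ * (‖u‖ * ‖f‖) := by
    have : 0 ≤ (l - 1) * ‖u‖ ^ 2 := mul_nonneg (by linarith) (sq_nonneg _)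
    nlinarith
  rcases (norm_nonneg u).eq_or_lt with hu0 | hu0
  · rw [← hu0]; positivity
  · rw [div_mul_eq_mul_div, le_div_iff₀ hηpos]
    refine le_of_mul_le_mul_right ?_ hu0
    linarith

/-- The polynomial `V + κ |x|²`. -/
def potPoly (κ : ℝ) : Poly :=
  MvPolynomial.X 0 ^ 2 * MvPolynomial.X 1 - MvPolynomial.C (1 / 3) * MvPolynomial.X 1 ^ 3 +
    MvPolynomial.C (κ : ℂ) * normSqPoly

theorem isRealPoly_potPoly (κ : ℝ) : IsRealPoly (potPoly κ) := by
  simp [IsRealPoly, potPoly, isRealPoly_normSqPoly.eq, map_ofNat]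

theorem polyEval_potPoly (κ : ℝ) (x : Plane) :
    polyEval (potPoly κ) x = ((potential x + κ * ‖x‖ ^ 2 : ℝ) : ℂ) := by
  simp [polyEval, potPoly, potential, normSqPoly, EuclideanSpace.norm_sq_eq]
  ring

theorem norm_polyEval_pderiv_potPoly_le (κ : ℝ) (j : Fin 2) (x : Plane) :
    ‖polyEval (MvPolynomial.pderiv j (potPoly κ)) x‖ ≤ (1 + |κ|) * ‖x‖ ^ 2 + |κ| := by
  have hκ := abs_nonneg κ
  have hn : ‖x‖ ^ 2 = x 0 ^ 2 + x 1 ^ 2 := by simp [EuclideanSpace.norm_sq_eq]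
  have hlin : ∀ t : ℝ, |2 * κ * t| ≤ |κ| * (t ^ 2 + 1) := fun t => by
    rw [abs_mul, abs_mul, Nat.abs_ofNat]
    nlinarith [sq_nonneg (|t| - 1), sq_abs t, abs_nonneg t]
  fin_cases j
  · have h1 : polyEval (MvPolynomial.pderiv 0 (potPoly κ)) x =
        ((2 * x 0 * x 1 + 2 * κ * x 0 : ℝ) : ℂ) := by
      simp [polyEval, potPoly, normSqPoly, Derivation.leibniz, MvPolynomial.pderiv_X]
      ring
    simp only [Fin.zero_eta]
    rw [h1, Complex.norm_real, Real.norm_eq_abs, hn]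
    refine (abs_add_le _ _).trans ?_
    have h2 : |2 * x 0 * x 1| ≤ x 0 ^ 2 + x 1 ^ 2 := by
      rw [abs_le]
      constructor <;> nlinarith [sq_nonneg (x 0 - x 1), sq_nonneg (x 0 + x 1)]
    nlinarith [hlin (x 0), mul_nonneg hκ (sq_nonneg (x 1))]
  · have h1 : polyEval (MvPolynomial.pderiv 1 (potPoly κ)) x =
        ((x 0 ^ 2 - x 1 ^ 2 + 2 * κ * x 1 : ℝ) : ℂ) := by
      simp [polyEval, potPoly, normSqPoly, Derivation.leibniz, MvPolynomial.pderiv_X]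
      ring
    simp only [Fin.mk_one]
    rw [h1, Complex.norm_real, Real.norm_eq_abs, hn]
    refine (abs_add_le _ _).trans ?_
    have h2 : |x 0 ^ 2 - x 1 ^ 2| ≤ x 0 ^ 2 + x 1 ^ 2 := by
      rw [abs_le]
      constructor <;> nlinarith [sq_nonneg (x 0), sq_nonneg (x 1)]
    nlinarith [hlin (x 1), mul_nonneg hκ (sq_nonneg (x 0))]

/-- Here degree three matters: the gradient of the potential is quadratic, hence dominated by |x|²
and a constant, both controlled by 1 + S. -/
theorem exists_norm_pderiv_potPoly_le (hτ : 0 < τ) (κ : ℝ) : ∃ C, ∀ j p,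
    ‖hermite hτ (MvPolynomial.pderiv j (potPoly κ) * p)‖ ≤ C * ‖hermite hτ (shiftPoly τ p)‖ := by
  obtain ⟨C, h⟩ := exists_norm_lapPoly_le hτ
  refine ⟨(1 + |κ|) * C + |κ|, fun j p => ?_⟩
  set r : Poly := ((1 + |κ| : ℝ) : ℂ) • (normSqPoly * p) + ((|κ| : ℝ) : ℂ) • p with hr
  have h1 : ‖hermite hτ (MvPolynomial.pderiv j (potPoly κ) * p)‖ ≤ ‖hermite hτ r‖ := by
    refine Lp.norm_le_norm_of_ae_le ?_
    filter_upwards [coeFn_hermite hτ (MvPolynomial.pderiv j (potPoly κ) * p), coeFn_hermite hτ r]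
      with x h1 h2
    have h3 : polyEval r x = (((1 + |κ|) * ‖x‖ ^ 2 + |κ| : ℝ) : ℂ) * polyEval p x := by
      have h4 := polyEval_normSqPoly x
      simp only [polyEval] at h4 ⊢
      simp only [hr, map_add, map_smul, map_mul, h4, smul_eq_mul]
      push_cast
      ring
    rw [h1, h2, polyGauss_apply, polyGauss_apply, polyEval_mul, h3, norm_mul, norm_mul, norm_mul,
      norm_mul, Complex.norm_real ((1 + |κ|) * ‖x‖ ^ 2 + |κ|),
      Real.norm_of_nonneg (by positivity : 0 ≤ (1 + |κ|) * ‖x‖ ^ 2 + |κ|)]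
    gcongr
    exact norm_polyEval_pderiv_potPoly_le κ j x
  refine h1.trans ?_
  rw [hr, map_add, map_smul, map_smul]
  refine (norm_add_le _ _).trans ?_
  rw [norm_smul, norm_smul, Complex.norm_real, Complex.norm_real, Real.norm_of_nonneg (by positivity),
    Real.norm_of_nonneg (by positivity), add_mul _ |κ| ‖hermite hτ (shiftPoly τ p)‖, mul_assoc]
  gcongr
  · exact (h p).2
  · exact norm_le_norm_shiftPoly hτ p

end

/-! ### Resolvents of the dilated operator -/

section

section PartialMaps

variable {E F : Type*} [AddCommGroup E] [Module ℂ E] [AddCommGroup F] [Module ℂ F]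

theorem mem_graph_add_iff {A B : E →ₗ.[ℂ] F} {u : E} {f : F} :
    (u, f) ∈ (A + B).graph ↔ ∃ f₁ f₂, (u, f₁) ∈ A.graph ∧ (u, f₂) ∈ B.graph ∧ f₁ + f₂ = f := by
  simp only [LinearPMap.mem_graph_iff]
  constructor
  · rintro ⟨⟨y, hy⟩, rfl, rfl⟩
    exact ⟨_, _, ⟨⟨y, hy.1⟩, rfl, rfl⟩, ⟨⟨y, hy.2⟩, rfl, rfl⟩, rfl⟩
  · rintro ⟨_, _, ⟨⟨y, hy⟩, rfl, rfl⟩, ⟨⟨y', hy'⟩, h, rfl⟩, rfl⟩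
    obtain rfl : y' = y := h
    exact ⟨⟨y', hy, hy'⟩, rfl, rfl⟩

theorem mem_graph_smul_iff {A : E →ₗ.[ℂ] F} {c : ℂ} {u : E} {f : F} :
    (u, f) ∈ (c • A).graph ↔ ∃ f₁, (u, f₁) ∈ A.graph ∧ c • f₁ = f := by
  simp only [LinearPMap.mem_graph_iff]
  constructor
  · rintro ⟨y, rfl, rfl⟩
    exact ⟨_, ⟨y, rfl, rfl⟩, rfl⟩
  · rintro ⟨_, ⟨y, rfl, rfl⟩, rfl⟩
    exact ⟨y, rfl, rfl⟩

end PartialMaps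

section Resolvent

variable {E : Type*} [NormedAddCommGroup E] [NormedSpace ℂ E] {T : E →ₗ.[ℂ] E} {z : ℂ}

theorem exists_isResolventAt {C : ℝ}
    (hs : ∀ f, ∃ u g, (u, g) ∈ T.graph ∧ z • u - g = f)
    (hC : ∀ u g, (u, g) ∈ T.graph → ‖u‖ ≤ C * ‖z • u - g‖) : ∃ R, IsResolventAt T z R := by
  let A : T.domain →ₗ[ℂ] E := z • T.domain.subtype - T.toFun
  have hA : ∀ u : T.domain, A u = z • (u : E) - T u := fun u => rfl
  have hinj : Function.Injective A := by
    rw [injective_iff_map_eq_zero]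
    intro u hu
    have := hC u (T u) (T.mem_graph u)
    rw [← hA, hu, norm_zero, mul_zero] at this
    exact Subtype.ext (norm_le_zero_iff.mp this)
  have hsurj : Function.Surjective A := fun f => by
    obtain ⟨u, g, hug, hf⟩ := hs f
    rw [LinearPMap.mem_graph_iff] at hug
    obtain ⟨y, rfl, rfl⟩ := hug
    exact ⟨y, hf⟩
  let B := LinearEquiv.ofBijective A ⟨hinj, hsurj⟩
  have hB : ∀ f, A (B.symm f) = f := fun f => B.apply_symm_apply f
  let R : E →L[ℂ] E := LinearMap.mkContinuous (T.domain.subtype ∘ₗ B.symm.toLinearMap) C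
    fun f => by
      have := hC _ _ (T.mem_graph (B.symm f))
      rw [← hA, hB] at this
      exact this
  refine ⟨R, fun f => ⟨(B.symm f).2, hB f⟩, fun u => ?_⟩
  have : B.symm (A u) = u := B.symm_apply_apply u
  exact congrArg Subtype.val this

theorem IsResolventAt.mem_graph_iff {R : E →L[ℂ] E} (hR : IsResolventAt T z R) {u g : E} :
    (u, g) ∈ T.graph ↔ R (z • u - g) = u := by
  constructor
  · intro h
    rw [LinearPMap.mem_graph_iff] at h
    obtain ⟨y, rfl, rfl⟩ := h
    exact hR.2 y
  · intro h
    obtain ⟨hd, h1⟩ := hR.1 (z • u - g)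
    rw [LinearPMap.mem_graph_iff]
    refine ⟨⟨_, hd⟩, h, ?_⟩
    nth_rw 1 [h] at h1
    exact sub_right_injective h1

/-- The graph is the solution set of an equation between continuous maps. -/
theorem IsResolventAt.isClosed {R : E →L[ℂ] E} (hR : IsResolventAt T z R) : T.IsClosed := by
  have : (T.graph : Set (E × E)) = {p | R (z • p.1 - p.2) = p.1} := by
    ext ⟨u, g⟩
    exact hR.mem_graph_iff
  change IsClosed (T.graph : Set (E × E))
  rw [this]
  exact isClosed_eq (by fun_prop) continuous_fst

/-- A bounded operator whose range lies in that of an injective compact operator is compact. -/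
theorem isCompactOperator_of_range_subset [CompleteSpace E] {K R : E →L[ℂ] E}
    (hK : IsCompactOperator K) (hinj : Function.Injective K) (h : ∀ f, ∃ y, K y = R f) :
    IsCompactOperator R := by
  choose q hq using h
  let Q : E →ₗ[ℂ] E :=
    { toFun := q
      map_add' := fun f g => hinj (by simp [hq])
      map_smul' := fun c f => hinj (by simp [hq]) }
  have hQ : Continuous Q := by
    -- Q = K⁻¹R is everywhere defined with closed graph, hence bounded, and R = KQ.
    refine Q.continuous_of_seq_closed_graph fun u x y hu hy => hinj ?_
    have h1 : Filter.Tendsto (fun n => K (Q (u n))) Filter.atTop (nhds (K y)) :=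
      (K.continuous.tendsto y).comp hy
    have h2 : Filter.Tendsto (fun n => K (Q (u n))) Filter.atTop (nhds (R x)) := by
      simp only [Q, LinearMap.coe_mk, AddHom.coe_mk, hq]
      exact (R.continuous.tendsto x).comp hu
    rw [tendsto_nhds_unique h1 h2]
    exact (hq x).symm
  have h3 : (R : E → E) = K ∘ (⟨Q, hQ⟩ : E →L[ℂ] E) := by
    funext f
    exact (hq f).symm
  rw [h3]
  exact hK.comp_clm _

end Resolvent

theorem mem_dilatedH_graph_iff {β θ : ℂ} {u f : L2} :
    (u, f) ∈ (dilatedH β θ).graph ↔ ∃ d m v, (u, d) ∈ laplacianGraph ∧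
      (u, m) ∈ (mulOp fun x => ‖x‖ ^ 2).graph ∧ (u, v) ∈ (mulOp potential).graph ∧
      (-Complex.exp (-2 * θ)) • d + Complex.exp (2 * θ) • m + (β * Complex.exp (3 * θ)) • v = f := by
  rw [dilatedH, mem_graph_add_iff]
  simp only [mem_graph_add_iff, mem_graph_smul_iff, laplaceOp_graph]
  constructor
  · rintro ⟨_, _, ⟨_, _, ⟨d, hd, rfl⟩, ⟨m, hm, rfl⟩, rfl⟩, ⟨v, hv, rfl⟩, rfl⟩
    exact ⟨d, m, v, hd, hm, hv, rfl⟩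
  · rintro ⟨d, m, v, hd, hm, hv, rfl⟩
    exact ⟨_, _, ⟨_, _, ⟨d, hd, rfl⟩, ⟨m, hm, rfl⟩, rfl⟩, ⟨v, hv, rfl⟩, rfl⟩

/-- Decomposition of the dilated operator for parameters in the region. -/
theorem exists_parameters {β θ : ℂ} (h : (β, θ) ∈ parameterRegion) :
    0 < (β * Complex.exp (5 * θ)).im ∧ ∃ τ κ : ℝ, 0 < τ ∧
      Complex.exp (4 * θ) = τ ^ 2 + κ * (β * Complex.exp (5 * θ)) := by
  obtain ⟨hβ, s, hs, h1, h2, h3, h4⟩ := h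
  simp only at hβ hs h1 h2 h3 h4
  have hpos : 0 < ‖β‖ := norm_pos_iff.mpr hβ
  have hb : β * Complex.exp (5 * θ) =
      (‖β‖ * Real.exp (5 * θ.re) : ℝ) * Complex.exp ((5 * θ.im + s : ℝ) * Complex.I) := by
    conv_lhs => rw [hs, ← Complex.re_add_im θ]
    push_cast
    rw [mul_assoc, mul_assoc, ← Complex.exp_add, ← Complex.exp_add]
    congr 2
    ring
  have ha : Complex.exp (4 * θ) =
      (Real.exp (4 * θ.re) : ℝ) * Complex.exp ((4 * θ.im : ℝ) * Complex.I) := by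
    conv_lhs => rw [← Complex.re_add_im θ]
    push_cast
    rw [← Complex.exp_add]
    congr 1
    ring
  set b := β * Complex.exp (5 * θ)
  set a := Complex.exp (4 * θ)
  have hbre : b.re = ‖β‖ * Real.exp (5 * θ.re) * Real.cos (5 * θ.im + s) := by
    rw [hb, Complex.re_ofReal_mul, Complex.exp_ofReal_mul_I_re]
  have hbim : b.im = ‖β‖ * Real.exp (5 * θ.re) * Real.sin (5 * θ.im + s) := by
    rw [hb, Complex.im_ofReal_mul, Complex.exp_ofReal_mul_I_im]
  have hare : a.re = Real.exp (4 * θ.re) * Real.cos (4 * θ.im) := by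
    rw [ha, Complex.re_ofReal_mul, Complex.exp_ofReal_mul_I_re]
  have haim : a.im = Real.exp (4 * θ.re) * Real.sin (4 * θ.im) := by
    rw [ha, Complex.im_ofReal_mul, Complex.exp_ofReal_mul_I_im]
  have hbpos : 0 < b.im := by
    rw [hbim]
    exact mul_pos (by positivity) (Real.sin_pos_of_pos_of_lt_pi h3 h4)
  -- The sign of sin((5t + s) - 4t) = sin(t + s): a lies on the same side of the line ℝb as the
  -- positive real axis.
  have hcross : 0 < a.re * b.im - a.im * b.re := by
    have : a.re * b.im - a.im * b.re =
        ‖β‖ * Real.exp (5 * θ.re) * Real.exp (4 * θ.re) * Real.sin (θ.im + s) := by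
      rw [show θ.im + s = (5 * θ.im + s) - 4 * θ.im by ring, Real.sin_sub, hare, haim, hbre, hbim]
      ring
    rw [this]
    exact mul_pos (by positivity) (Real.sin_pos_of_pos_of_lt_pi h1 h2)
  -- Imaginary parts in a = τ² + κb fix κ, and real parts then fix τ².
  refine ⟨hbpos, Real.sqrt ((a.re * b.im - a.im * b.re) / b.im), a.im / b.im,
    Real.sqrt_pos.mpr (div_pos hcross hbpos), ?_⟩
  rw [← Complex.ofReal_pow, Real.sq_sqrt (div_pos hcross hbpos).le]
  apply Complex.ext
  · rw [Complex.add_re, Complex.ofReal_re, Complex.re_ofReal_mul]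
    field_simp
    ring
  · rw [Complex.add_im, Complex.ofReal_im, Complex.im_ofReal_mul]
    field_simp
    ring

theorem exists_isResolventAt_dilatedH {β θ : ℂ} (h : (β, θ) ∈ parameterRegion) :
    ∃ z R, IsResolventAt (dilatedH β θ) z R := by
  obtain ⟨hb, τ, κ, hτ, ha⟩ := exists_parameters h
  set b := β * Complex.exp (5 * θ) with hbdef
  obtain ⟨C, hC⟩ := exists_norm_pderiv_potPoly_le hτ κ
  obtain ⟨l, hl, hsol⟩ := exists_solution hτ (isRealPoly_potPoly κ) hC hb
  set c := Complex.exp (-2 * θ) with hc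
  have hc0 : c ≠ 0 := Complex.exp_ne_zero _
  have hc2 : Complex.exp (2 * θ) = c * Complex.exp (4 * θ) := by
    rw [hc, ← Complex.exp_add]; congr 1; ring
  have hc3 : β * Complex.exp (3 * θ) = c * b := by
    rw [hc, hbdef, mul_left_comm, ← Complex.exp_add]; congr 2; ring
  -- On D(|x|²), the domains of V and V + κ|x|² coincide, so moving κb|x|² into the potential does
  -- not change the domain of the sum.
  have hpot : ∀ u m v : L2, (u, m) ∈ (mulOp fun x => ‖x‖ ^ 2).graph →
      ((u, v) ∈ (mulOp potential).graph ↔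
        (u, v + (κ : ℂ) • m) ∈ (mulOp fun x => potential x + κ * ‖x‖ ^ 2).graph) := by
    intro u m v hm
    rw [mem_mulOp_graph_iff] at hm
    rw [mem_mulOp_graph_iff, mem_mulOp_graph_iff]
    have h1 := Lp.coeFn_add v ((κ : ℂ) • m)
    have h2 := Lp.coeFn_smul (κ : ℂ) m
    constructor <;> intro h <;> filter_upwards [h, hm, h1, h2] with x hx hm h1 h2
    · rw [h1, Pi.add_apply, h2, Pi.smul_apply, ← hx, ← hm, smul_eq_mul]
      push_cast
      ring
    · rw [h1, Pi.add_apply, h2, Pi.smul_apply, ← hm, smul_eq_mul] at hx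
      push_cast at hx ⊢
      linear_combination hx
  -- At z = -cl one has z - H = -c(S + l + bW), and l = 1 + (l - 1) matches the form solved above.
  refine ⟨-c * l, exists_isResolventAt (C := ‖b⁻¹‖ / -(b⁻¹).im * ‖c⁻¹‖) (fun f => ?_)
    fun u g hug => ?_⟩
  · obtain ⟨y, g, hg, hy⟩ := hsol (-c⁻¹ • f)
    have hm := oscResolvent_mem_mulOp_graph hτ y
    have hg' : (oscResolvent hτ y, g) ∈ (mulOp fun x => potential x + κ * ‖x‖ ^ 2).graph := by
      rw [mem_mulOp_graph_iff]
      filter_upwards [hg] with x hx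
      rw [← hx, polyEval_potPoly]
    refine ⟨oscResolvent hτ y, _, mem_dilatedH_graph_iff.mpr ⟨lapResolvent hτ y,
      normSqResolvent hτ y, g - (κ : ℂ) • normSqResolvent hτ y,
      oscResolvent_mem_laplacianGraph hτ y, hm, ?_, rfl⟩, ?_⟩
    · rw [hpot _ _ _ hm, sub_add_cancel]
      exact hg'
    · have hy' := shift_oscResolvent hτ y
      have hf : f = -c • (y + ((l - 1 : ℝ) : ℂ) • oscResolvent hτ y + b • g) := by
        rw [hy, smul_smul, neg_mul_neg, mul_inv_cancel₀ hc0, one_smul]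
      rw [hf, hc2, hc3, ha]
      nth_rw 5 [← hy']
      push_cast
      module
  · obtain ⟨d, m, v, hd, hm, hv, rfl⟩ := mem_dilatedH_graph_iff.mp hug
    have hu := eq_oscResolvent hτ hd hm
    set y := -d + (τ ^ 2 : ℂ) • m + u with hy
    rw [hpot u m v hm] at hv
    have key := norm_oscResolvent_le_of_eq hτ hb hl (v := fun x => potential x + κ * ‖x‖ ^ 2)
      (y := y) (g := v + (κ : ℂ) • m) (by rwa [← hu]) rfl
    rw [← hu] at key
    have hX : (-c * l) • u - (-c • d + Complex.exp (2 * θ) • m + (β * Complex.exp (3 * θ)) • v) =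
        (-c) • (y + ((l - 1 : ℝ) : ℂ) • u + b • (v + (κ : ℂ) • m)) := by
      rw [hc2, hc3, ha, hy]
      push_cast
      module
    rw [hX, norm_smul, norm_neg, mul_assoc, ← mul_assoc ‖c⁻¹‖, ← norm_mul, inv_mul_cancel₀ hc0,
      norm_one, one_mul]
    exact key

theorem exists_oscResolvent_eq_of_mem_domain {τ : ℝ} (hτ : 0 < τ) {u : L2}
    (h1 : u ∈ laplaceOp.domain) (h2 : u ∈ (mulOp fun x => ‖x‖ ^ 2).domain) :
    ∃ y, oscResolvent hτ y = u := by
  have hd := laplaceOp.mem_graph ⟨u, h1⟩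
  rw [laplaceOp_graph] at hd
  exact ⟨_, (eq_oscResolvent hτ hd ((mulOp fun x => ‖x‖ ^ 2).mem_graph ⟨u, h2⟩)).symm⟩

theorem hasCompactResolvents_dilatedH {β θ : ℂ} (h : (β, θ) ∈ parameterRegion) :
    HasCompactResolvents (dilatedH β θ) := by
  refine ⟨exists_isResolventAt_dilatedH h, fun z R hR => ?_⟩
  refine isCompactOperator_of_range_subset (isCompactOperator_oscResolvent one_pos)
    (oscResolvent_injective one_pos) fun f => ?_
  obtain ⟨hd, -⟩ := hR.1 f
  exact exists_oscResolvent_eq_of_mem_domain one_pos hd.1.1 hd.1.2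

end

/-! ### The domain of the harmonic oscillator and the parameter region -/

section

open Filter Topology
open scoped LineDeriv

/-- The product of `φ` and the dilation `x ↦ c (ε x)`. -/
def cutoff (c : 𝓢(Plane, ℂ)) (ε : ℝ) (φ : 𝓢(Plane, ℂ)) : 𝓢(Plane, ℂ) :=
  SchwartzMap.smulLeftCLM ℂ (fun x => c (ε • x)) φ

theorem hasTemperateGrowth_dilation (c : 𝓢(Plane, ℂ)) (ε : ℝ) :
    (fun x : Plane => c (ε • x)).HasTemperateGrowth :=
  c.hasTemperateGrowth.comp (g := c) (f := (ε • ContinuousLinearMap.id ℝ Plane))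
    (ContinuousLinearMap.hasTemperateGrowth _)

theorem cutoff_apply (c : 𝓢(Plane, ℂ)) (ε : ℝ) (φ : 𝓢(Plane, ℂ)) (x : Plane) :
    cutoff c ε φ x = c (ε • x) * φ x :=
  SchwartzMap.smulLeftCLM_apply_apply (hasTemperateGrowth_dilation c ε) φ x

theorem lineDeriv_cutoff (c : 𝓢(Plane, ℂ)) (ε : ℝ) (φ : 𝓢(Plane, ℂ)) (m : Plane) :
    ∂_{m} (cutoff c ε φ) = cutoff c ε (∂_{m} φ) + (ε : ℂ) • cutoff (∂_{m} c) ε φ := by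
  ext x
  have h1 : HasFDerivAt (fun y : Plane => c (ε • y))
      ((fderiv ℝ c (ε • x)).comp (ε • ContinuousLinearMap.id ℝ Plane)) x :=
    (c.hasFDerivAt (ε • x)).comp x (ε • ContinuousLinearMap.id ℝ Plane).hasFDerivAt
  have h2 := h1.mul (φ.hasFDerivAt x)
  have h3 : (cutoff c ε φ : Plane → ℂ) = (fun y => c (ε • y)) * φ := funext (cutoff_apply c ε φ)
  rw [SchwartzMap.lineDerivOp_apply_eq_fderiv, h3, h2.fderiv]
  simp only [add_apply, smul_apply, cutoff_apply, SchwartzMap.lineDerivOp_apply_eq_fderiv,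
    ContinuousLinearMap.comp_apply, ContinuousLinearMap.id_apply,
    map_smul, smul_eq_mul, Complex.real_smul]
  ring

theorem exists_norm_sub_le (c : 𝓢(Plane, ℂ)) : ∃ C : ℝ, 0 ≤ C ∧ ∀ x, ‖c x - c 0‖ ≤ C * ‖x‖ := by
  obtain ⟨C, hC0, hC⟩ := c.decay 0 1
  refine ⟨C, hC0.le, fun x => ?_⟩
  have := Convex.norm_image_sub_le_of_norm_fderiv_le (𝕜 := ℝ) (f := c) (s := Set.univ) (C := C)
    (x := 0) (y := x) (fun y _ => c.differentiableAt) (fun y _ => by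
      have := hC y
      rwa [pow_zero, one_mul, norm_iteratedFDeriv_one] at this) convex_univ trivial trivial
  rwa [sub_zero] at this

/-- c is Lipschitz, so the error is at most C|ε||x||φ|, and φ absorbs the weight |x|. -/
theorem tendsto_toLp_cutoff (c φ : 𝓢(Plane, ℂ)) :
    Tendsto (fun ε : ℝ => (cutoff c ε φ).toLp 2 volume) (𝓝 0) (𝓝 (c 0 • φ.toLp 2 volume)) := by
  obtain ⟨C, hC0, hC⟩ := exists_norm_sub_le c
  have hg : (fun x : Plane => (1 + ‖x‖ ^ 2 : ℝ)).HasTemperateGrowth := by fun_prop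
  let ψ := SchwartzMap.smulLeftCLM ℂ (fun x : Plane => (1 + ‖x‖ ^ 2 : ℝ)) φ
  have hψ : ∀ x, ψ x = ((1 + ‖x‖ ^ 2 : ℝ) : ℂ) * φ x := fun x => by
    rw [← Complex.real_smul]
    exact SchwartzMap.smulLeftCLM_apply_apply hg φ x
  rw [tendsto_iff_norm_sub_tendsto_zero]
  refine squeeze_zero (g := fun ε : ℝ => C * |ε| * ‖ψ.toLp 2 volume‖) (fun _ => norm_nonneg _)
    (fun ε => ?_) ?_
  · refine Lp.norm_le_mul_norm_of_ae_le_mul ?_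
    filter_upwards [Lp.coeFn_sub ((cutoff c ε φ).toLp 2 volume) (c 0 • φ.toLp 2 volume),
      Lp.coeFn_smul (c 0) (φ.toLp 2 volume), φ.coeFn_toLp 2 volume, ψ.coeFn_toLp 2 volume,
      (cutoff c ε φ).coeFn_toLp 2 volume] with x h1 h2 h3 h4 h5
    rw [h1, Pi.sub_apply, h2, Pi.smul_apply, h3, h4, h5, cutoff_apply, smul_eq_mul, ← sub_mul, hψ,
      norm_mul, norm_mul, ← mul_assoc, Complex.norm_real]
    refine mul_le_mul_of_nonneg_right ((hC _).trans ?_) (norm_nonneg _)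
    rw [norm_smul, Real.norm_eq_abs, Real.norm_of_nonneg (by positivity), mul_assoc]
    refine mul_le_mul_of_nonneg_left (mul_le_mul_of_nonneg_left ?_ (abs_nonneg _)) hC0
    nlinarith [sq_nonneg (‖x‖ - 1)]
  · have : Continuous fun ε : ℝ => C * |ε| * ‖ψ.toLp 2 volume‖ := by fun_prop
    simpa using this.tendsto 0

theorem toLp_add (φ ψ : 𝓢(Plane, ℂ)) :
    (φ + ψ).toLp 2 volume = φ.toLp 2 volume + ψ.toLp 2 volume :=
  map_add (SchwartzMap.toLpCLM ℂ ℂ 2 (volume : Measure Plane)) φ ψ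

theorem toLp_smul (a : ℂ) (φ : 𝓢(Plane, ℂ)) :
    (a • φ).toLp 2 volume = a • φ.toLp 2 volume :=
  map_smul (SchwartzMap.toLpCLM ℂ ℂ 2 (volume : Measure Plane)) a φ

/-- Each derivative falling on the dilated cutoff gains a factor ε, so only the term with both
derivatives on φ survives. -/
theorem tendsto_toLp_lineDeriv_lineDeriv_cutoff (c φ : 𝓢(Plane, ℂ)) (m : Plane) :
    Tendsto (fun ε : ℝ => (∂_{m} (∂_{m} (cutoff c ε φ))).toLp 2 volume) (𝓝 0)
      (𝓝 (c 0 • (∂_{m} (∂_{m} φ)).toLp 2 volume)) := by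
  have he : Tendsto (fun ε : ℝ => (ε : ℂ)) (𝓝 0) (𝓝 0) := by
    simpa using (Complex.continuous_ofReal.tendsto 0)
  have h1 := tendsto_toLp_cutoff c (∂_{m} (∂_{m} φ))
  have h2 := he.smul (tendsto_toLp_cutoff (∂_{m} c) (∂_{m} φ))
  have h3 := he.smul (he.smul (tendsto_toLp_cutoff (∂_{m} (∂_{m} c)) φ))
  have h := (h1.add h2).add (h2.add h3)
  simp only [zero_smul, add_zero] at h
  refine h.congr fun ε => ?_
  rw [lineDeriv_cutoff, LineDeriv.lineDerivOp_add, lineDeriv_cutoff, LineDeriv.lineDerivOp_smul,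
    lineDeriv_cutoff]
  simp only [toLp_add, toLp_smul, smul_add]

theorem tendsto_toLp_laplacian_cutoff (c φ : 𝓢(Plane, ℂ)) :
    Tendsto (fun ε : ℝ => (Δ (cutoff c ε φ)).toLp 2 volume) (𝓝 0)
      (𝓝 (c 0 • (Δ φ).toLp 2 volume)) := by
  simp only [SchwartzMap.laplacian_eq_sum (EuclideanSpace.basisFun (Fin 2) ℝ), Fin.sum_univ_two,
    toLp_add, smul_add]
  exact (tendsto_toLp_lineDeriv_lineDeriv_cutoff c φ _).add
    (tendsto_toLp_lineDeriv_lineDeriv_cutoff c φ _)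

/-- Multiplication by `|x|²` on Schwartz functions. -/
def normSqMul : 𝓢(Plane, ℂ) →L[ℂ] 𝓢(Plane, ℂ) :=
  SchwartzMap.smulLeftCLM ℂ fun x : Plane => ((‖x‖ ^ 2 : ℝ) : ℂ)

theorem normSqMul_apply (φ : 𝓢(Plane, ℂ)) (x : Plane) :
    normSqMul φ x = ((‖x‖ ^ 2 : ℝ) : ℂ) * φ x := by
  refine SchwartzMap.smulLeftCLM_apply_apply ?_ φ x
  fun_prop

theorem normSqMul_cutoff (c : 𝓢(Plane, ℂ)) (ε : ℝ) (φ : 𝓢(Plane, ℂ)) :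
    normSqMul (cutoff c ε φ) = cutoff c ε (normSqMul φ) := by
  ext x
  rw [normSqMul_apply, cutoff_apply, cutoff_apply, normSqMul_apply, mul_left_comm]

theorem toLp_mem_mulOp_graph (φ : 𝓢(Plane, ℂ)) :
    ((φ.toLp 2 volume, (normSqMul φ).toLp 2 volume) : L2 × L2) ∈
      (mulOp fun x => ‖x‖ ^ 2).graph := by
  rw [mem_mulOp_graph_iff]
  filter_upwards [φ.coeFn_toLp 2 volume, (normSqMul φ).coeFn_toLp 2 volume] with x h1 h2
  rw [h1, h2, normSqMul_apply]

/-- The operator sum `-Δ + |x|²`. -/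
def oscSum : L2 →ₗ.[ℂ] L2 := -laplaceOp + mulOp (fun x => ‖x‖ ^ 2)

theorem mem_oscSum_graph_iff {u f : L2} :
    (u, f) ∈ oscSum.graph ↔ ∃ d m, (u, d) ∈ laplacianGraph ∧
      (u, m) ∈ (mulOp fun x => ‖x‖ ^ 2).graph ∧ -d + m = f := by
  rw [oscSum, mem_graph_add_iff]
  constructor
  · rintro ⟨a, m, ha, hm, rfl⟩
    rw [LinearPMap.mem_graph_iff] at ha
    obtain ⟨y, rfl, rfl⟩ := ha
    exact ⟨laplaceOp y, m, laplaceOp_graph ▸ laplaceOp.mem_graph y, hm, rfl⟩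
  · rintro ⟨d, m, hd, hm, rfl⟩
    rw [← laplaceOp_graph, LinearPMap.mem_graph_iff] at hd
    obtain ⟨y, rfl, rfl⟩ := hd
    exact ⟨_, m, (-laplaceOp).mem_graph y, hm, rfl⟩

/-- The sum is exactly the inverse of its resolvent minus 1, which makes it closed without any
further estimate. -/
theorem oscSum_graph_eq :
    (oscSum.graph : Set (L2 × L2)) = {p | p.1 = oscResolvent one_pos (p.2 + p.1)} := by
  ext ⟨u, f⟩
  simp only [SetLike.mem_coe, mem_oscSum_graph_iff, Set.mem_ofPred_eq]
  constructor
  · rintro ⟨d, m, hd, hm, rfl⟩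
    simpa using eq_oscResolvent one_pos hd hm
  · intro h
    refine ⟨lapResolvent one_pos (f + u), normSqResolvent one_pos (f + u), ?_, ?_, ?_⟩
    · nth_rw 1 [h]
      exact oscResolvent_mem_laplacianGraph _ _
    · nth_rw 1 [h]
      exact oscResolvent_mem_mulOp_graph _ _
    · have := shift_oscResolvent one_pos (f + u)
      rw [← h] at this
      simpa using this

theorem isClosed_oscSum : oscSum.IsClosed := by
  change IsClosed (oscSum.graph : Set (L2 × L2))
  rw [oscSum_graph_eq]
  exact isClosed_eq (by fun_prop) (by fun_prop)

theorem isClosable_oscSum_domRestrict : (oscSum.domRestrict testFunctions).IsClosable :=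
  isClosed_oscSum.isClosable.leIsClosable LinearPMap.domRestrict_le

theorem mem_domRestrict_graph {E F : Type*} [AddCommGroup E] [Module ℂ E] [AddCommGroup F]
    [Module ℂ F] {A : E →ₗ.[ℂ] F} {S : Submodule ℂ E} {u : E} {f : F} (h : (u, f) ∈ A.graph)
    (hu : u ∈ S) : (u, f) ∈ (A.domRestrict S).graph := by
  rw [LinearPMap.mem_graph_iff] at h ⊢
  obtain ⟨y, rfl, rfl⟩ := h
  exact ⟨⟨y, hu, y.2⟩, rfl, LinearPMap.domRestrict_apply rfl⟩

theorem exists_cutoff : ∃ c : 𝓢(Plane, ℂ), HasCompactSupport c ∧ c 0 = 1 := by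
  let b : ContDiffBump (0 : Plane) := ⟨1, 2, one_pos, one_lt_two⟩
  have h1 : HasCompactSupport (Complex.ofRealCLM ∘ b) := b.hasCompactSupport.comp_left rfl
  have h2 : ContDiff ℝ ∞ (Complex.ofRealCLM ∘ b) := Complex.ofRealCLM.contDiff.comp b.contDiff
  refine ⟨h1.toSchwartzMap h2, h1, ?_⟩
  change ((b 0 : ℝ) : ℂ) = 1
  rw [b.one_of_mem_closedBall (by simp [b]), Complex.ofReal_one]

theorem toLp_cutoff_mem_testFunctions {c : 𝓢(Plane, ℂ)} (hc : HasCompactSupport c) {ε : ℝ}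
    (hε : ε ≠ 0) (φ : 𝓢(Plane, ℂ)) : (cutoff c ε φ).toLp 2 volume ∈ testFunctions := by
  refine ⟨cutoff c ε φ, (cutoff c ε φ).smooth _, ?_, (cutoff c ε φ).coeFn_toLp 2 volume⟩
  have h1 : HasCompactSupport fun x : Plane => c (ε • x) :=
    hc.comp_homeomorph (Homeomorph.smulOfNeZero ε hε)
  have h2 : (cutoff c ε φ : Plane → ℂ) = (fun x => c (ε • x)) * φ := funext (cutoff_apply c ε φ)
  rw [h2]
  exact h1.mul_right

/-- Schwartz functions are in the domain of the harmonic oscillator. -/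
theorem toLp_mem_harmonicOscillator_graph (φ : 𝓢(Plane, ℂ)) :
    ((φ.toLp 2 volume, -(Δ φ).toLp 2 volume + (normSqMul φ).toLp 2 volume) : L2 × L2) ∈
      harmonicOscillator.graph := by
  obtain ⟨c, hc, hc0⟩ := exists_cutoff
  change _ ∈ (oscSum.domRestrict testFunctions).closure.graph
  rw [← isClosable_oscSum_domRestrict.graph_closure_eq_closure_graph]
  have h1 := tendsto_toLp_cutoff c φ
  have h2 := (tendsto_toLp_laplacian_cutoff c φ).neg.add (tendsto_toLp_cutoff c (normSqMul φ))
  have h := (h1.prodMk_nhds h2).mono_left (nhdsWithin_le_nhds (s := {0}ᶜ))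
  simp only [hc0, one_smul] at h
  refine mem_closure_of_tendsto h ?_
  filter_upwards [self_mem_nhdsWithin] with ε hε
  refine mem_domRestrict_graph ?_ (toLp_cutoff_mem_testFunctions hc hε φ)
  rw [mem_oscSum_graph_iff]
  refine ⟨_, _, toLp_mem_laplacianGraph _, toLp_mem_mulOp_graph _, ?_⟩
  rw [normSqMul_cutoff]

/-- Test functions form a core: polynomials times a Gaussian lie in the closure by cutting off, and
1 + S maps them onto a dense subspace, so the closure contains the whole graph of the resolvent. -/
theorem harmonicOscillator_graph : harmonicOscillator.graph = oscSum.graph := by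
  have hcl : harmonicOscillator.graph =
      (oscSum.domRestrict testFunctions).graph.topologicalClosure :=
    isClosable_oscSum_domRestrict.graph_closure_eq_closure_graph.symm
  refine le_antisymm ?_ ?_
  · rw [hcl]
    exact Submodule.topologicalClosure_minimal _
      (LinearPMap.le_graph_of_le LinearPMap.domRestrict_le) isClosed_oscSum
  · rintro ⟨u, f⟩ h
    have hu : u = oscResolvent one_pos (f + u) := by
      have : (u, f) ∈ (oscSum.graph : Set (L2 × L2)) := h
      rwa [oscSum_graph_eq] at this
    have key : ∀ y : L2, (oscResolvent one_pos y, y - oscResolvent one_pos y) ∈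
        harmonicOscillator.graph := fun y => by
      refine (denseRange_hermiteShift one_pos).induction_on (p := fun y =>
        (oscResolvent one_pos y, y - oscResolvent one_pos y) ∈ harmonicOscillator.graph) y ?_
        fun p => ?_
      · rw [hcl]
        exact (Submodule.isClosed_topologicalClosure _).preimage (by fun_prop)
      · have h1 := toLp_mem_harmonicOscillator_graph (polyGauss one_pos p)
        rw [laplacian_polyGauss_eq, ← hermite_apply, ← hermite_apply] at h1
        have h2 : (normSqMul (polyGauss one_pos p)).toLp 2 volume =
            hermite one_pos (normSqPoly * p) := by
          rw [hermite_apply]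
          congr 1
          ext x
          rw [normSqMul_apply, polyGauss_apply, polyGauss_apply, polyEval_mul]
          simp only [polyEval_normSqPoly]
          ring
        rw [h2] at h1
        rw [oscResolvent_hermiteShift, hermiteShift_apply, shiftPoly_apply, oscPoly_apply]
        simpa using h1
    have h3 := key (f + u)
    rwa [← hu, add_sub_cancel_right] at h3

theorem harmonicOscillator_domain :
    harmonicOscillator.domain = laplaceOp.domain ⊓ (mulOp fun x => ‖x‖ ^ 2).domain := by
  rw [LinearPMap.eq_of_eq_graph harmonicOscillator_graph]
  rfl

theorem dilatedH_domain (β θ : ℂ) :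
    (dilatedH β θ).domain = harmonicOscillator.domain ⊓ (mulOp potential).domain := by
  rw [harmonicOscillator_domain]
  rfl

/-- A logarithm of β uniformizes the choice of s: the region is the image of a convex open tube
under an open continuous map, hence open and connected. -/
theorem parameterRegion_eq_image :
    parameterRegion = Prod.map Complex.exp id '' {p : ℂ × ℂ | (p.1.im, p.2.im) ∈ parallelogram} := by
  ext ⟨β, θ⟩
  constructor
  · rintro ⟨hβ, s, hs, h⟩
    refine ⟨(Real.log ‖β‖ + s * Complex.I, θ), by simpa using h, ?_⟩
    refine Prod.ext ?_ rfl
    change Complex.exp _ = β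
    rw [Complex.exp_add, ← Complex.ofReal_exp, Real.exp_log (norm_pos_iff.mpr hβ)]
    exact hs.symm
  · rintro ⟨⟨w, θ'⟩, h, heq⟩
    obtain ⟨rfl, rfl⟩ := Prod.mk.inj heq
    refine ⟨Complex.exp_ne_zero w, w.im, ?_, h⟩
    change Complex.exp w = _
    rw [Complex.norm_exp, Complex.ofReal_exp, ← Complex.exp_add, Complex.re_add_im]

theorem isOpen_parallelogram : IsOpen parallelogram := by
  simp only [parallelogram, Set.ofPred_and]
  refine IsOpen.inter ?_ (IsOpen.inter ?_ (IsOpen.inter ?_ ?_)) <;>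
    exact isOpen_lt (by fun_prop) (by fun_prop)

theorem convex_parallelogram : Convex ℝ parallelogram := by
  have h : ∀ r : ℝ, IsLinearMap ℝ fun p : ℝ × ℝ => r * p.2 + p.1 := fun r =>
    ⟨fun p q => by simp; ring, fun a p => by simp; ring⟩
  have h1 := h 1
  simp only [one_mul] at h1
  exact (convex_halfSpace_gt h1 0).inter ((convex_halfSpace_lt h1 _).inter
    ((convex_halfSpace_gt (h 5) 0).inter (convex_halfSpace_lt (h 5) _)))

theorem isOpen_parameterRegion : IsOpen parameterRegion := by
  rw [parameterRegion_eq_image]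
  refine (Complex.isOpenMap_exp.prodMap IsOpenMap.id) _ (isOpen_parallelogram.preimage ?_)
  fun_prop

theorem isConnected_parameterRegion : IsConnected parameterRegion := by
  rw [parameterRegion_eq_image]
  refine IsConnected.image (Convex.isConnected ?_ ?_) _ ?_
  · exact convex_parallelogram.linear_preimage
      ((Complex.imLm.comp (LinearMap.fst ℝ ℂ ℂ)).prod (Complex.imLm.comp (LinearMap.snd ℝ ℂ ℂ)))
  -- This point corresponds to s = π/2, t = 0, the centre of the parallelogram.
  · refine ⟨((Real.pi / 2 : ℝ) * Complex.I, 0), ?_⟩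
    have := Real.pi_pos
    simp only [parallelogram, Set.mem_ofPred_eq, Complex.im_ofReal_mul, Complex.I_im,
      Complex.zero_im]
    refine ⟨?_, ?_, ?_, ?_⟩ <;> linarith
  · exact (Complex.continuous_exp.prodMap continuous_id).continuousOn

theorem isHolomorphicFamilyTypeA_dilatedH :
    IsHolomorphicFamilyTypeA parameterRegion (fun p : ℂ × ℂ => dilatedH p.1 p.2)
      (harmonicOscillator.domain ⊓ (mulOp potential).domain) where
  isOpen := isOpen_parameterRegion
  isConnected := isConnected_parameterRegion
  isClosed p hp := by
    obtain ⟨z, R, hR⟩ := exists_isResolventAt_dilatedH (β := p.1) (θ := p.2) hp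
    exact hR.isClosed
  domain_eq p _ := dilatedH_domain p.1 p.2
  holomorphic u hu := by
    rw [harmonicOscillator_domain] at hu
    obtain ⟨⟨hd, hm⟩, hv⟩ := hu
    refine ⟨fun p => (-Complex.exp (-2 * p.2)) • laplaceOp ⟨u, hd⟩ +
      Complex.exp (2 * p.2) • mulOp _ ⟨u, hm⟩ +
      (p.1 * Complex.exp (3 * p.2)) • mulOp potential ⟨u, hv⟩, ?_, fun p _ => ?_⟩
    · refine Differentiable.differentiableOn ?_
      fun_prop
    · exact mem_dilatedH_graph_iff.mpr ⟨_, _, _, laplaceOp_graph ▸ laplaceOp.mem_graph ⟨u, hd⟩,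
        LinearPMap.mem_graph _ ⟨u, hm⟩, LinearPMap.mem_graph _ ⟨u, hv⟩, rfl⟩

end

end HenonHeiles

end

theorem theorem2p6 :
    HenonHeiles.IsHolomorphicFamilyTypeA HenonHeiles.parameterRegion
        (fun p : ℂ × ℂ => HenonHeiles.dilatedH p.1 p.2)
        (HenonHeiles.harmonicOscillator.domain ⊓
          (HenonHeiles.mulOp HenonHeiles.potential).domain) ∧
      ∀ p ∈ HenonHeiles.parameterRegion,
        HenonHeiles.HasCompactResolvents (HenonHeiles.dilatedH p.1 p.2) :=
  ⟨HenonHeiles.isHolomorphicFamilyTypeA_dilatedH,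
    fun _ hp => HenonHeiles.hasCompactResolvents_dilatedH hp⟩
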